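/- Let $\mathbf k$ be a field of characteristic zero. A $\mathbf k[\partial]$-module is a $\mathbf k$-vector space with an endomorphism $\partial$; $V[\lambda]$ denotes polynomials with coefficients in $V$, and tensor products are over $\mathbf k$. For $\mathbf k[\partial]$-modules $U,V$, $\mathrm{Chom}(U,V)$ is the space of $\mathbf k$-linear maps $a_\lambda:U\to V[\lambda]$ with $a_\lambda(\partial u)=(\lambda+\partial)a_\lambda u$, a $\mathbf k[\partial]$-module via $(\partial a)_\lambda u=-\lambda a_\lambda u$; $\mathrm{Cend}(V)=\mathrm{Chom}(V,V)$ and $U^{*c}=\mathrm{Chom}(U,\mathbf k)$ with $\partial=0$ on $\mathbf k$; write $\langle f,u\rangle_\lambda=f_\lambda u$. When $-\lambda-\partial$ or $\lambda+\partial$ is substituted for the variable of a polynomial with coefficients in a module, $\partial$ acts on the coefficients. A Leibniz conformal algebra is a $\mathbf k[\partial]$-module $Q$ with a $\mathbf k$-bilinear map $[\cdot_\lambda\cdot]:Q\times Q\to Q[\lambda]$ such that $[\partial a_\lambda b]=-\lambda[a_\lambda b]$, $[a_\lambda\partial b]=(\lambda+\partial)[a_\lambda b]$ and $[a_\lambda[b_\mu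 c]]=[[a_\lambda b]_{\lambda+\mu}c]+[b_\mu[a_\lambda c]]$. A representation of $Q$ is a $\mathbf k[\partial]$-module $M$ with $\mathbf k[\partial]$-module homomorphisms $l,r:Q\to\mathrm{Cend}(M)$ such that, for all $a,b\in Q$ and $v\in M$, $$l(a)_\lambda(l(b)_\mu v)=l([a_\lambda b])_{\lambda+\mu}v+l(b)_\mu(l(a)_\lambda v),$$ $$l(a)_\lambda(r(b)_{-\mu-\partial}v)=r(b)_{-\lambda-\mu-\partial}(l(a)_\lambda v)+r([a_\lambda b])_{-\mu-\partial}v,$$ $$r(b)_{-\lambda-\mu-\partial}(r(a)_{-\mu-\partial}v)=-r(b)_{-\lambda-\mu-\partial}(l(a)_\lambda v).$$ The semidirect product $Q\ltimes_{l,r}M$ is the Leibniz conformal algebra $Q\oplus M$ with $$[(a+x)_\lambda(b+y)]=[a_\lambda b]+l(a)_\lambda y+r(b)_{-\lambda-\partial}x.$$ If $M$ is finitely generated over $\mathbf k[\partial]$, the dual representation is $(M^{*c},l^*,-l^*-r^*)$, where $\langle l^*(a)_\lambda f,v\rangle_\mu=-\langle f,l(a)_\lambda v\rangle_{\mu-\lambda}$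 and $\langle r^*(a)_\lambda f,v\rangle_\mu=-\langle f,r(a)_\lambda v\rangle_{\mu-\lambda}$. For a Leibniz conformal algebra $P$ and $r=\sum_i a_i\otimes b_i\in P\otimes P$, put $$[[r,r]]=\sum_{i,j}\Big([{a_i}_\mu a_j]\otimes b_i\otimes b_j\big|_{\mu=\partial_2}+a_i\otimes a_j\otimes[{b_j}_\mu b_i]\big|_{\mu=\partial_2}-a_i\otimes[{b_i}_\mu a_j]\otimes b_j\big|_{\mu=\partial_1}-a_i\otimes[{a_j}_\mu b_i]\otimes b_j\big|_{\mu=-\partial_1-\partial_2}\Big),$$ where $\partial_i$ is $\partial$ acting on the $i$-th factor of $P^{\otimes 3}$. Then $r$ is a solution of the classical Leibniz conformal Yang–Baxter equation (CLCYBE) in $P$ if $[[r,r]]\in(\partial_1+\partial_2+\partial_3)(P\otimes P\otimes P)$, and $r$ is symmetric if $\tau r=r$, where $\tau(a\otimes b)=b\otimes a$. A $\mathbf k[\partial]$-module homomorphism $S:M\to Q$ is an $\mathcal O$-operator on $Q$ associated to $(M,l,r)$ if $[S(x)_\lambda S(y)]=S\big(l(S(x))_\lambda y+r(S(y))_{-\lambda-\partial}x\big)$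 for all $x,y\in M$. **Theorem.** Let $Q$ be a Leibniz conformal algebra and $(M,l,r)$ a representation of $Q$, with $Q$ and $M$ both finitely generated and free over $\mathbf k[\partial]$. Let $\eta:\mathrm{Chom}(M,Q)\to M^{*c}\otimes Q$ be the inverse of the isomorphism $\varphi:M^{*c}\otimes Q\to\mathrm{Chom}(M,Q)$, $\varphi(f\otimes a)_\lambda v=\langle f,v\rangle_{\lambda+\partial}\,a$ (here $\partial$ acts on $a\in Q$). Let $T\in\mathrm{Chom}(M,Q)$ and regard $\eta(T)\in M^{*c}\otimes Q$ as an element of $P\otimes P$, where $P=Q\ltimes_{l^*,-l^*-r^*}M^{*c}$. Then $\eta(T)+\tau\eta(T)$ is a symmetric solution of the CLCYBE in $P$ if and only if $T_0=T_\lambda|_{\lambda=0}:M\to Q$ is an $\mathcal O$-operator on $Q$ associated to $(M,l,r)$. -/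

import Mathlib

open scoped Polynomial TensorProduct

namespace LeibnizConformal


noncomputable section

/-! ## Polynomials with coefficients in a module, and substitution -/

/-- The action of `∂` on a `k[∂]`-module, as a `k`-linear endomorphism. -/
def del (k : Type*) [Field k] (V : Type*) [AddCommGroup V] [Module k V] [Module k[X] V]
    [IsScalarTower k k[X] V] : Module.End k V :=
  Algebra.lsmul k k V (Polynomial.X : k[X])

/-- `V[λ]`: polynomials in one variable with coefficients in `V`; the value at `n` is the
coefficient of `λ ^ n`.  If `V` is a `k[∂]`-module, `∂` acts on `V[λ]` coefficientwise. -/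
abbrev VPoly (V : Type*) [AddCommGroup V] : Type _ := ℕ →₀ V

/-- `V[λ, μ] = V[λ][μ]`. -/
abbrev VPoly₂ (V : Type*) [AddCommGroup V] : Type _ := VPoly (VPoly V)

section Poly

variable (k : Type*) [Field k] {V W : Type*} [AddCommGroup V] [Module k V]
  [AddCommGroup W] [Module k W]

/-- Multiplication by the variable on `V[λ]`. -/
def lam (V : Type*) [AddCommGroup V] [Module k V] : Module.End k (VPoly V) :=
  Finsupp.lmapDomain V k Nat.succ

/-- The constants `V → V[λ]`. -/
def const (V : Type*) [AddCommGroup V] [Module k V] : V →ₗ[k] VPoly V :=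
  Finsupp.lsingle 0

/-- Multiplication by `λ` on `V[λ, μ]`. -/
def varL (V : Type*) [AddCommGroup V] [Module k V] : Module.End k (VPoly₂ V) :=
  Finsupp.mapRange.linearMap (lam k V)

/-- Multiplication by `μ` on `V[λ, μ]`. -/
def varM (V : Type*) [AddCommGroup V] [Module k V] : Module.End k (VPoly₂ V) :=
  lam k (VPoly V)

/-- The constants `V → V[λ, μ]`. -/
def const₂ (V : Type*) [AddCommGroup V] [Module k V] : V →ₗ[k] VPoly₂ V :=
  const k (VPoly V) ∘ₗ const k V

variable {k}

/-- Substitution of an operator `D` for the variable: `∑ λ ^ n v_n ↦ ∑ D ^ n (φ v_n)`. -/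
def subst (D : Module.End k W) (φ : V →ₗ[k] W) : VPoly V →ₗ[k] W :=
  Finsupp.lsum k fun n => (D ^ n) ∘ₗ φ

/-- `p(λ) ↦ p(-λ-∂)`, where `∂` acts on the coefficients of `p`. -/
def skew (k : Type*) [Field k] (V : Type*) [AddCommGroup V] [Module k V] [Module k[X] V]
    [IsScalarTower k k[X] V] : VPoly V →ₗ[k] VPoly V :=
  subst (-lam k V - del k (VPoly V)) (const k V)

end Poly

/-! ### Evaluation at scalars -/

section Eval

variable {k : Type*} [Field k] {V W : Type*} [AddCommGroup V] [Module k V]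
  [AddCommGroup W] [Module k W]

theorem lam_zero (p : VPoly V) : (lam k V p) 0 = 0 := by
  simp only [lam, Finsupp.lmapDomain_apply]
  exact Finsupp.mapDomain_of_notMem_range _ _ (by simp)

theorem lam_succ (p : VPoly V) (n : ℕ) : (lam k V p) (n + 1) = p n := by
  simp only [lam, Finsupp.lmapDomain_apply]
  exact Finsupp.mapDomain_apply Nat.succ_injective _ _

theorem del_coeff [Module k[X] V] [IsScalarTower k k[X] V] (p : VPoly V) (n : ℕ) :
    (del k (VPoly V) p) n = del k V (p n) := by
  simp [del]

theorem lam_single (n : ℕ) (v : V) :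
    lam k V (Finsupp.single n v) = Finsupp.single (n + 1) v := by
  simp [lam, Finsupp.mapDomain_single]

theorem subst_single (D : Module.End k W) (φ : V →ₗ[k] W) (n : ℕ) (v : V) :
    subst D φ (Finsupp.single n v) = (D ^ n) (φ v) := by
  simp [subst]

theorem subst_lam (D : Module.End k W) (φ : V →ₗ[k] W) (p : VPoly V) :
    subst D φ (lam k V p) = D (subst D φ p) := by
  induction p using Finsupp.induction_linear with
  | zero => simp
  | add p q hp hq => simp only [map_add, hp, hq]
  | single n v => rw [lam_single, subst_single, subst_single, pow_succ']; rfl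

theorem subst_add (D : Module.End k W) (φ ψ : V →ₗ[k] W) (p : VPoly V) :
    subst D (φ + ψ) p = subst D φ p + subst D ψ p := by
  induction p using Finsupp.induction_linear with
  | zero => simp
  | add p q hp hq => simp only [map_add, hp, hq]; abel
  | single n v => simp [subst_single]

theorem subst_smul (D : Module.End k W) (φ : V →ₗ[k] W) (c : k) (p : VPoly V) :
    subst D (c • φ) p = c • subst D φ p := by
  induction p using Finsupp.induction_linear with
  | zero => simp
  | add p q hp hq => simp only [map_add, hp, hq, smul_add]
  | single n v => simp [subst_single]

/-- Linear maps intertwining the operators commute with substitution. -/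
theorem map_subst {Z : Type*} [AddCommGroup Z] [Module k Z] (g : W →ₗ[k] Z)
    (D : Module.End k W) (D' : Module.End k Z) (h : ∀ w, g (D w) = D' (g w))
    (φ : V →ₗ[k] W) (p : VPoly V) : g (subst D φ p) = subst D' (g ∘ₗ φ) p := by
  induction p using Finsupp.induction_linear with
  | zero => simp
  | add p q hp hq => simp only [map_add, hp, hq]
  | single n v =>
    rw [subst_single, subst_single, LinearMap.comp_apply]
    generalize φ v = w
    induction n generalizing w with
    | zero => simp
    | succ n ih => rw [pow_succ, pow_succ, Module.End.mul_apply, Module.End.mul_apply, ih, h]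

/-- The value `p(s)` of `p ∈ V[λ]` at a scalar `s`. -/
def ev (s : k) : VPoly V →ₗ[k] V := subst (s • 1) LinearMap.id

/-- The value `p(s, t)` of `p ∈ V[λ, μ]` at scalars `s`, `t`. -/
def ev₂ (s t : k) : VPoly₂ V →ₗ[k] V := ev s ∘ₗ ev t

theorem subst_scalar (s : k) (φ : V →ₗ[k] W) (p : VPoly V) :
    subst (s • 1) φ p = φ (ev s p) := by
  rw [ev, map_subst φ (s • 1) (s • 1) (by simp)]; rfl

theorem ev_lam (s : k) (p : VPoly V) : ev s (lam k V p) = s • ev s p := by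
  rw [ev, subst_lam]; simp

theorem ev_mapRange (s : k) (f : V →ₗ[k] W) (p : VPoly V) :
    ev s (Finsupp.mapRange.linearMap f p) = f (ev s p) := by
  induction p using Finsupp.induction_linear with
  | zero => simp
  | add p q hp hq => simp only [map_add, hp, hq]
  | single n v => simp [ev, subst_single, smul_pow]

theorem ev_const (s : k) (v : V) : ev s (const k V v) = v := by
  simp [ev, const, subst_single]

theorem del_eq_mapRange [Module k[X] V] [IsScalarTower k k[X] V] (p : VPoly V) :
    del k (VPoly V) p = Finsupp.mapRange.linearMap (del k V) p := by
  ext n; simp [del]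

theorem ev_del [Module k[X] V] [IsScalarTower k k[X] V] (s : k) (p : VPoly V) :
    ev s (del k (VPoly V) p) = del k V (ev s p) := by
  rw [del_eq_mapRange, ev_mapRange]

theorem ev₂_varL (s t : k) (p : VPoly₂ V) : ev₂ s t (varL k V p) = s • ev₂ s t p := by
  simp only [ev₂, varL, LinearMap.comp_apply, ev_mapRange, ev_lam]

theorem ev₂_varM (s t : k) (p : VPoly₂ V) : ev₂ s t (varM k V p) = t • ev₂ s t p := by
  simp only [ev₂, varM, LinearMap.comp_apply, ev_lam, map_smul]

theorem ev₂_const (s t : k) (v : V) : ev₂ s t (const₂ k V v) = v := by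
  simp only [ev₂, const₂, LinearMap.comp_apply, ev_const]

theorem ev₂_del [Module k[X] V] [IsScalarTower k k[X] V] (s t : k) (p : VPoly₂ V) :
    ev₂ s t (del k (VPoly₂ V) p) = del k V (ev₂ s t p) := by
  simp only [ev₂, LinearMap.comp_apply, ev_del]

/-- The value `p(-s-∂)`. -/
def evS [Module k[X] V] [IsScalarTower k k[X] V] (s : k) : VPoly V →ₗ[k] V :=
  subst (-(s • 1) - del k V) LinearMap.id

theorem ev_skew [Module k[X] V] [IsScalarTower k k[X] V] (s : k) (p : VPoly V) :
    ev s (skew k V p) = evS s p := by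
  rw [skew, map_subst (ev s) _ (-(s • 1) - del k V) (by simp [ev_lam, ev_del]), evS]
  congr 1
  exact congrArg _ (LinearMap.ext fun v => ev_const s v)

theorem ev₂_subst {U : Type*} [AddCommGroup U] [Module k U] (s t c : k)
    (D : Module.End k (VPoly₂ V))
    (h : ∀ w, ev₂ s t (D w) = c • ev₂ s t w) (φ : U →ₗ[k] VPoly₂ V) (p : VPoly U) :
    ev₂ s t (subst D φ p) = ev₂ s t (φ (ev c p)) := by
  rw [map_subst (ev₂ s t) D (c • 1) (by simpa using h), subst_scalar]; rfl

theorem ev₂_subst_const (s t c : k) (D : Module.End k (VPoly₂ V))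
    (h : ∀ w, ev₂ s t (D w) = c • ev₂ s t w) (p : VPoly V) :
    ev₂ s t (subst D (const₂ k V) p) = ev c p := by
  rw [ev₂_subst s t c D h, ev₂_const]

theorem ev₂_subst_const_del [Module k[X] V] [IsScalarTower k k[X] V] (s t c : k)
    (D : Module.End k (VPoly₂ V))
    (h : ∀ w, ev₂ s t (D w) = -(c • ev₂ s t w) - del k V (ev₂ s t w)) (p : VPoly V) :
    ev₂ s t (subst D (const₂ k V) p) = evS c p := by
  rw [map_subst (ev₂ s t) D (-(c • 1) - del k V) (by simpa using h), evS]
  congr 1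
  exact congrArg _ (LinearMap.ext fun v => ev₂_const s t v)

theorem vpoly_ext [Infinite k] {p q : VPoly V} (h : ∀ s : k, ev s p = ev s q) : p = q := by
  rw [← sub_eq_zero]
  have h' : ∀ s : k, ev s (p - q) = 0 := fun s => by rw [map_sub, h, sub_self]
  generalize p - q = p at h'
  ext n
  rw [Finsupp.zero_apply, ← Module.forall_dual_apply_eq_zero_iff k]
  intro ψ
  let P : VPoly V →ₗ[k] k[X] := subst (LinearMap.mulLeft k Polynomial.X)
    ((Algebra.linearMap k k[X]) ∘ₗ ψ)
  have hP : ∀ (p : VPoly V) (s : k), (P p).eval s = ψ (ev s p) := by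
    intro p s
    induction p using Finsupp.induction_linear with
    | zero => simp
    | add p q hp hq => simp only [map_add, hp, hq, Polynomial.eval_add]
    | single n v =>
      simp [P, ev, subst_single, LinearMap.pow_mulLeft, smul_pow]
      ring
  have hc : ∀ (p : VPoly V) (n : ℕ), (P p).coeff n = ψ (p n) := by
    intro p n
    induction p using Finsupp.induction_linear with
    | zero => simp
    | add p q hp hq => simp [hp, hq]
    | single m v =>
      simp only [P, subst_single, LinearMap.pow_mulLeft, LinearMap.comp_apply,
        LinearMap.mulLeft_apply, Algebra.linearMap_apply, Polynomial.algebraMap_eq]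
      rw [mul_comm, Polynomial.coeff_C_mul_X_pow]
      by_cases hmn : n = m
      · simp [hmn]
      · rw [if_neg hmn, Finsupp.single_apply, if_neg (Ne.symm hmn), map_zero]
  rw [← hc, Polynomial.funext (p := P p) (q := 0) (fun s => by rw [hP, h']; simp)]
  simp

theorem vpoly₂_ext [Infinite k] {p q : VPoly₂ V} (h : ∀ s t : k, ev₂ s t p = ev₂ s t q) :
    p = q :=
  vpoly_ext (k := k) fun t => vpoly_ext (k := k) fun s => h s t

end Eval

/-! ## Leibniz conformal algebras -/

/-- A Leibniz conformal algebra structure on the `k[∂]`-module `Q`. -/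
structure LeibnizConformalAlgebra (k : Type*) [Field k] (Q : Type*) [AddCommGroup Q]
    [Module k Q] [Module k[X] Q] [IsScalarTower k k[X] Q] where
  /-- the bracket `[a_λ b]` -/
  bracket : Q →ₗ[k] Q →ₗ[k] VPoly Q
  /-- `[∂a_λ b] = -λ[a_λ b]` -/
  del_left : ∀ a b, bracket (del k Q a) b = -lam k Q (bracket a b)
  /-- `[a_λ ∂b] = (λ + ∂)[a_λ b]` -/
  del_right : ∀ a b, bracket a (del k Q b) = (lam k Q + del k (VPoly Q)) (bracket a b)
  /-- `[a_λ [b_μ c]] = [[a_λ b]_{λ+μ} c] + [b_μ [a_λ c]]` in `Q[λ, μ]` -/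
  jacobi : ∀ a b c,
    subst (varM k Q) (subst (varL k Q) (const₂ k Q) ∘ₗ bracket a) (bracket b c) =
      subst (varL k Q) (subst (varL k Q + varM k Q) (const₂ k Q) ∘ₗ bracket.flip c)
          (bracket a b) +
        subst (varL k Q) (subst (varM k Q) (const₂ k Q) ∘ₗ bracket b) (bracket a c)

/-! ## Conformal linear maps and the conformal dual -/

section Twist

variable {k : Type*} [Field k] {A : Type*} [AddCommGroup A] [Module k A]

/-- The `k[∂]`-module structure in which `∂` acts by a given endomorphism. -/
abbrev moduleOfEnd (D : Module.End k A) : Module k[X] A :=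
  Module.compHom A (Polynomial.aeval (R := k) D).toRingHom

end Twist

section Chom

variable (k : Type*) [Field k]
  (U : Type*) [AddCommGroup U] [Module k U] [Module k[X] U] [IsScalarTower k k[X] U]
  (V : Type*) [AddCommGroup V] [Module k V] [Module k[X] V] [IsScalarTower k k[X] V]

/-- Conformal linear maps `a_λ : U → V[λ]`, i.e. `a_λ (∂u) = (λ + ∂) a_λ u`. -/
def chomSubmodule : Submodule k (U →ₗ[k] VPoly V) where
  carrier := {a | ∀ u, a (del k U u) = (lam k V + del k (VPoly V)) (a u)}
  add_mem' {a b} ha hb u := by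
    have ha' := ha u
    have hb' := hb u
    simp only [LinearMap.add_apply, map_add] at *
    rw [ha', hb']
  zero_mem' u := by simp
  smul_mem' c a ha u := by
    have ha' := ha u
    simp only [LinearMap.smul_apply, map_smul] at *
    rw [ha']

/-- `Chom(U, V)`. -/
def Chom : Type _ := chomSubmodule k U V

instance : AddCommGroup (Chom k U V) := inferInstanceAs (AddCommGroup (chomSubmodule k U V))
instance : Module k (Chom k U V) := inferInstanceAs (Module k (chomSubmodule k U V))

variable {k U V}

/-- The underlying map of a conformal linear map, `u ↦ a_λ u`. -/
def Chom.toLin : Chom k U V →ₗ[k] U →ₗ[k] VPoly V := (chomSubmodule k U V).subtype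

instance : CoeFun (Chom k U V) fun _ => U → VPoly V := ⟨fun a => a.toLin⟩

theorem Chom.map_del (a : Chom k U V) (u : U) :
    a (del k U u) = (lam k V + del k (VPoly V)) (a u) := a.2 u

theorem Chom.ext {a b : Chom k U V} (h : ∀ u, a u = b u) : a = b :=
  Subtype.ext (LinearMap.ext h)

theorem lam_comm_del (p : VPoly V) :
    lam k V (del k (VPoly V) p) = del k (VPoly V) (lam k V p) := by
  induction p using Finsupp.induction_linear with
  | zero => simp
  | add p q hp hq => simp [hp, hq]
  | single n v =>
    simp [lam, del, Finsupp.mapDomain_single]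

variable (k U V)

/-- The action of `∂` on `Chom(U, V)`: `(∂a)_λ u = -λ a_λ u`. -/
def Chom.delEnd : Module.End k (Chom k U V) where
  toFun a := ⟨-(lam k V ∘ₗ a.toLin), fun u => by
    have h := a.map_del u
    simp only [LinearMap.neg_apply, LinearMap.comp_apply, map_neg, LinearMap.add_apply] at *
    rw [h, map_add, lam_comm_del]⟩
  map_add' a b := Chom.ext fun u => by
    change -(lam k V ((a + b).toLin u)) = -(lam k V (a.toLin u)) + -(lam k V (b.toLin u))
    rw [map_add, LinearMap.add_apply, map_add, neg_add]
  map_smul' c a := Chom.ext fun u => by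
    change -(lam k V ((c • a).toLin u)) = c • -(lam k V (a.toLin u))
    rw [map_smul, LinearMap.smul_apply, map_smul, smul_neg]

instance : Module k[X] (Chom k U V) := moduleOfEnd (Chom.delEnd k U V)

instance : IsScalarTower k k[X] (Chom k U V) where
  smul_assoc c p a := by
    change Polynomial.aeval (Chom.delEnd k U V) (c • p) a =
      c • Polynomial.aeval (Chom.delEnd k U V) p a
    rw [map_smul]; rfl

theorem Chom.del_eq : del k (Chom k U V) = Chom.delEnd k U V := by
  ext1 a
  change Polynomial.aeval (Chom.delEnd k U V) Polynomial.X a = _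
  rw [Polynomial.aeval_X]

theorem Chom.del_apply (a : Chom k U V) (u : U) :
    (del k (Chom k U V) a) u = -lam k V (a u) := by
  rw [Chom.del_eq]; rfl

variable {k U V}

/-- A `k`-linear map commuting with `∂` is `k[∂]`-linear. -/
def linOfDel (f : U →ₗ[k] V) (h : ∀ u, f (del k U u) = del k V (f u)) : U →ₗ[k[X]] V where
  toFun := f
  map_add' := f.map_add
  map_smul' p u := by
    simp only [RingHom.id_apply]
    induction p using Polynomial.induction_on' generalizing u with
    | add p q hp hq => simp only [add_smul, map_add, hp, hq]
    | monomial n c =>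
      rw [← mul_one c, ← smul_eq_mul, ← Polynomial.smul_monomial, ← Polynomial.X_pow_eq_monomial,
        smul_assoc, smul_assoc, map_smul]
      congr 1
      induction n generalizing u with
      | zero => simp
      | succ n ih =>
        rw [pow_succ, mul_smul, mul_smul, ih]
        congr 1
        exact h u

/-- `T_0 = T_λ|_{λ=0}`, which is a homomorphism of `k[∂]`-modules. -/
def Chom.atZero (T : Chom k U V) : U →ₗ[k[X]] V :=
  linOfDel (Finsupp.lapply 0 ∘ₗ T.toLin) fun u => by
    have h := T.map_del u
    simp only [LinearMap.comp_apply, Finsupp.lapply_apply]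
    rw [h]
    have : (lam k V (T u)) 0 = 0 := by
      simp only [lam, Finsupp.lmapDomain_apply]
      exact Finsupp.mapDomain_of_notMem_range _ _ (by simp)
    simp [this, del]

end Chom

section Dual

variable (k : Type*) [Field k]
  (U : Type*) [AddCommGroup U] [Module k U] [Module k[X] U] [IsScalarTower k k[X] U]

/-- `k`-linear maps `f : U → k[λ]` with `f_λ (∂u) = λ f_λ u`. -/
def cdualSubmodule : Submodule k (U →ₗ[k] k[X]) where
  carrier := {f | ∀ u, f (del k U u) = Polynomial.X * f u}
  add_mem' {f g} hf hg u := by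
    have hf' := hf u
    have hg' := hg u
    simp only [LinearMap.add_apply] at *
    rw [hf', hg', mul_add]
  zero_mem' u := by simp
  smul_mem' c f hf u := by
    have hf' := hf u
    simp only [LinearMap.smul_apply] at *
    rw [hf', mul_smul_comm]

/-- The conformal dual `U^{*c} = Chom(U, k)`, with `∂` acting trivially on `k`. -/
def CDual : Type _ := cdualSubmodule k U

instance : AddCommGroup (CDual k U) := inferInstanceAs (AddCommGroup (cdualSubmodule k U))
instance : Module k (CDual k U) := inferInstanceAs (Module k (cdualSubmodule k U))

variable {k U}

/-- The pairing `f, u ↦ ⟨f, u⟩_λ = f_λ u`. -/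
def pair : CDual k U →ₗ[k] U →ₗ[k] k[X] := (cdualSubmodule k U).subtype

theorem CDual.ext {f g : CDual k U} (h : ∀ u, pair f u = pair g u) : f = g :=
  Subtype.ext (LinearMap.ext h)

theorem pair_del (f : CDual k U) (u : U) : pair f (del k U u) = Polynomial.X * pair f u := f.2 u

variable (k U)

variable {k U}

/-- Constructor for elements of the conformal dual. -/
def CDual.mk (f : U →ₗ[k] k[X]) (h : ∀ u, f (del k U u) = Polynomial.X * f u) : CDual k U := ⟨f, h⟩

theorem pair_mk (f : U →ₗ[k] k[X]) (h : ∀ u, f (del k U u) = Polynomial.X * f u) :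
    pair (CDual.mk f h) = f := rfl

variable (k U)

/-- The action of `∂` on `U^{*c}`: `⟨∂f, u⟩_λ = -λ ⟨f, u⟩_λ`. -/
def CDual.delEnd : Module.End k (CDual k U) where
  toFun f := CDual.mk (-(LinearMap.mulLeft k (Polynomial.X : k[X]) ∘ₗ pair f)) fun u => by
    simp [pair_del]
  map_add' f g := CDual.ext fun u => by
    simp only [map_add, pair_mk, LinearMap.add_apply, LinearMap.neg_apply, LinearMap.comp_apply,
      LinearMap.mulLeft_apply]
    ring
  map_smul' c f := CDual.ext fun u => by
    simp only [map_smul, pair_mk, LinearMap.smul_apply, LinearMap.neg_apply,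
      LinearMap.comp_apply, RingHom.id_apply, smul_neg]

instance : Module k[X] (CDual k U) := moduleOfEnd (CDual.delEnd k U)

instance : IsScalarTower k k[X] (CDual k U) where
  smul_assoc c p a := by
    change Polynomial.aeval (CDual.delEnd k U) (c • p) a =
      c • Polynomial.aeval (CDual.delEnd k U) p a
    rw [map_smul]; rfl

theorem CDual.del_eq : del k (CDual k U) = CDual.delEnd k U := by
  ext1 a
  change Polynomial.aeval (CDual.delEnd k U) Polynomial.X a = _
  rw [Polynomial.aeval_X]

theorem pair_del_left (f : CDual k U) (u : U) :
    pair (del k (CDual k U) f) u = -(Polynomial.X * pair f u) := by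
  rw [CDual.del_eq]
  simp [CDual.delEnd, pair_mk]

end Dual

/-! ## Dual actions -/

section DualAction

variable {k : Type*} [Field k]
  {M : Type*} [AddCommGroup M] [Module k M] [Module k[X] M] [IsScalarTower k k[X] M]

/-- `v ↦ -⟨f, g_λ v⟩_{μ-λ}` as an element of `k[μ][λ]`. -/
def dualPoly (g : Chom k M M) (f : CDual k M) : M →ₗ[k] k[X][X] :=
  -(subst (LinearMap.mulLeft k (Polynomial.X : k[X][X]))
      ((Polynomial.aeval (Polynomial.C Polynomial.X - Polynomial.X : k[X][X])).toLinearMap ∘ₗ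
        pair f) ∘ₗ g.toLin)

theorem dualPoly_del (g : Chom k M M) (f : CDual k M) (v : M) :
    dualPoly g f (del k M v) = Polynomial.C Polynomial.X * dualPoly g f v := by
  have key : ∀ p : VPoly M,
      subst (LinearMap.mulLeft k (Polynomial.X : k[X][X]))
        ((Polynomial.aeval (Polynomial.C Polynomial.X - Polynomial.X : k[X][X])).toLinearMap ∘ₗ
        pair f) ((lam k M + del k (VPoly M)) p) =
      Polynomial.C Polynomial.X * subst (LinearMap.mulLeft k (Polynomial.X : k[X][X]))
        ((Polynomial.aeval (Polynomial.C Polynomial.X - Polynomial.X : k[X][X])).toLinearMap ∘ₗ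
        pair f) p := by
    intro p
    rw [LinearMap.add_apply, map_add, subst_lam, LinearMap.mulLeft_apply]
    induction p using Finsupp.induction_linear with
    | zero => simp
    | add p q hp hq =>
      simp only [map_add, mul_add] at *
      rw [← hp, ← hq]; abel
    | single n v =>
      have : del k (VPoly M) (Finsupp.single n v) = Finsupp.single n (del k M v) := by
        simp [del]
      rw [this]
      simp [subst, LinearMap.pow_mulLeft, pair_del]
      ring
  have h := key (g v)
  rw [← g.map_del] at h
  rw [dualPoly, LinearMap.neg_apply, LinearMap.neg_apply, LinearMap.comp_apply,
    LinearMap.comp_apply, h]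
  ring

theorem dualPoly_bounded [Module.Finite k[X] M] (g : Chom k M M) (f : CDual k M) :
    ∃ N : ℕ, ∀ v, ∀ n, N ≤ n → (dualPoly g f v).coeff n = 0 := by
  let B : M →ₗ[k[X]] k[X][X] := linOfDel (dualPoly g f) fun v => by
    rw [dualPoly_del, ← Polynomial.smul_eq_C_mul]; rfl
  obtain ⟨S, hS⟩ := (Module.Finite.fg_top : (⊤ : Submodule k[X] M).FG)
  refine ⟨S.sup fun v => (B v).natDegree + 1, fun v n hn => ?_⟩
  have hv : v ∈ Submodule.span k[X] (S : Set M) := hS ▸ Submodule.mem_top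
  change (B v).coeff n = 0
  induction hv using Submodule.span_induction with
  | mem x hx =>
    have : (B x).natDegree + 1 ≤ S.sup fun v => (B v).natDegree + 1 :=
      Finset.le_sup (f := fun v => (B v).natDegree + 1) hx
    exact Polynomial.coeff_eq_zero_of_natDegree_lt (by omega)
  | zero => simp
  | add x y _ _ hx hy => simp [hx, hy]
  | smul a x _ hx => rw [map_smul, Polynomial.coeff_smul, hx, smul_zero]

/-- The coefficient of `λ ^ n` in `g*_λ f`. -/
def dualCoeff (g : Chom k M M) (f : CDual k M) (n : ℕ) : CDual k M :=
  CDual.mk (((Polynomial.lcoeff k[X] n).restrictScalars k) ∘ₗ dualPoly g f) fun v => by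
    simp [dualPoly_del]

theorem pair_dualCoeff (g : Chom k M M) (f : CDual k M) (n : ℕ) (v : M) :
    pair (dualCoeff g f n) v = (dualPoly g f v).coeff n := rfl

theorem dual_ext {p q : VPoly (CDual k M)} (h : ∀ n v, pair (p n) v = pair (q n) v) :
    p = q :=
  Finsupp.ext fun n => CDual.ext fun v => h n v

theorem dualPoly_add (g : Chom k M M) (f f' : CDual k M) (v : M) :
    dualPoly g (f + f') v = dualPoly g f v + dualPoly g f' v := by
  simp only [dualPoly, LinearMap.neg_apply, LinearMap.comp_apply, map_add, LinearMap.comp_add,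
    subst_add, neg_add]

theorem dualPoly_smul (g : Chom k M M) (c : k) (f : CDual k M) (v : M) :
    dualPoly g (c • f) v = c • dualPoly g f v := by
  simp only [dualPoly, LinearMap.neg_apply, LinearMap.comp_apply, map_smul, LinearMap.comp_smul,
    subst_smul, smul_neg]

theorem dualPoly_add_left (g g' : Chom k M M) (f : CDual k M) (v : M) :
    dualPoly (g + g') f v = dualPoly g f v + dualPoly g' f v := by
  simp only [dualPoly, LinearMap.neg_apply, LinearMap.comp_apply, map_add, LinearMap.add_apply,
    neg_add]

theorem dualPoly_smul_left (g : Chom k M M) (c : k) (f : CDual k M) (v : M) :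
    dualPoly (c • g) f v = c • dualPoly g f v := by
  simp only [dualPoly, LinearMap.neg_apply, LinearMap.comp_apply, map_smul, LinearMap.smul_apply,
    smul_neg]

theorem dualPoly_del_left (g : Chom k M M) (f : CDual k M) (v : M) :
    dualPoly (del k (Chom k M M) g) f v = -(Polynomial.X * dualPoly g f v) := by
  rw [dualPoly, dualPoly, LinearMap.neg_apply, LinearMap.neg_apply, LinearMap.comp_apply,
    LinearMap.comp_apply, Chom.del_apply, map_neg, subst_lam, LinearMap.mulLeft_apply]
  ring

theorem dualPoly_del_mid (g : Chom k M M) (f : CDual k M) (v : M) :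
    dualPoly g (del k (CDual k M) f) v =
      (Polynomial.X - Polynomial.C Polynomial.X) * dualPoly g f v := by
  rw [dualPoly, dualPoly, LinearMap.neg_apply, LinearMap.neg_apply, LinearMap.comp_apply,
    LinearMap.comp_apply]
  generalize g.toLin v = p
  suffices h : subst (LinearMap.mulLeft k (Polynomial.X : k[X][X]))
      ((Polynomial.aeval (Polynomial.C Polynomial.X - Polynomial.X : k[X][X])).toLinearMap ∘ₗ
        pair (del k (CDual k M) f)) p =
      (Polynomial.X - Polynomial.C Polynomial.X) *
        subst (LinearMap.mulLeft k (Polynomial.X : k[X][X]))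
      ((Polynomial.aeval (Polynomial.C Polynomial.X - Polynomial.X : k[X][X])).toLinearMap ∘ₗ
        pair f) p by
    rw [h]; ring
  induction p using Finsupp.induction_linear with
  | zero => simp
  | add p q hp hq => simp only [map_add, hp, hq, mul_add]
  | single n v =>
    simp only [subst_single, LinearMap.pow_mulLeft, LinearMap.mulLeft_apply,
      LinearMap.comp_apply, pair_del_left, AlgHom.toLinearMap_apply, map_neg, map_mul,
      Polynomial.aeval_X]
    ring

theorem lam_coeff_dual (P : VPoly (CDual k M)) (B : k[X][X]) (v : M)
    (h : ∀ n, pair (P n) v = B.coeff n) (n : ℕ) :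
    pair ((lam k _ P) n) v = (Polynomial.X * B).coeff n := by
  cases n with
  | zero => rw [lam_zero]; simp
  | succ n => rw [lam_succ, h, Polynomial.coeff_X_mul]

variable [Module.Finite k[X] M]

/-- `g*_λ f ∈ M^{*c}[λ]`, determined by `⟨g*_λ f, v⟩_μ = -⟨f, g_λ v⟩_{μ-λ}`. -/
def dualVal (g : Chom k M M) (f : CDual k M) : VPoly (CDual k M) :=
  Finsupp.onFinset (Finset.range (dualPoly_bounded g f).choose) (dualCoeff g f) fun n hn => by
    by_contra h
    exact hn (CDual.ext fun v => by
      rw [pair_dualCoeff, (dualPoly_bounded g f).choose_spec v n (by simpa using h)]; simp)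

theorem dualVal_apply (g : Chom k M M) (f : CDual k M) (n : ℕ) (v : M) :
    pair (dualVal g f n) v = (dualPoly g f v).coeff n := rfl

/-- The conformal endomorphism `g*` of `M^{*c}` with `⟨g*_λ f, v⟩_μ = -⟨f, g_λ v⟩_{μ-λ}`. -/
def dualChom (g : Chom k M M) : Chom k (CDual k M) (CDual k M) :=
  ⟨{ toFun := dualVal g
     map_add' := fun f f' => dual_ext fun n v => by
      simp only [Finsupp.add_apply, map_add, LinearMap.add_apply, dualVal_apply, dualPoly_add,
        Polynomial.coeff_add]
     map_smul' := fun c f => dual_ext fun n v => by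
      simp only [Finsupp.smul_apply, map_smul, LinearMap.smul_apply, dualVal_apply,
        dualPoly_smul, Polynomial.coeff_smul, RingHom.id_apply] }, fun f => dual_ext fun n v => by
      change pair (dualVal g (del k _ f) n) v =
        pair ((lam k _ (dualVal g f)) n + (del k _ (dualVal g f)) n) v
      rw [dualVal_apply, dualPoly_del_mid, sub_mul, Polynomial.coeff_sub,
        Polynomial.coeff_C_mul, map_add, LinearMap.add_apply, del_coeff, pair_del_left,
        dualVal_apply, lam_coeff_dual _ _ v (fun n => dualVal_apply g f n v), sub_eq_add_neg]⟩

theorem dualChom_apply (g : Chom k M M) (f : CDual k M) (n : ℕ) (v : M) :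
    pair (dualChom g f n) v = (dualPoly g f v).coeff n := rfl

variable (k M) in
/-- `g ↦ g*`, as a homomorphism of `k[∂]`-modules `Cend(M) → Cend(M^{*c})`. -/
def dualCend : Chom k M M →ₗ[k[X]] Chom k (CDual k M) (CDual k M) :=
  linOfDel
    { toFun := dualChom
      map_add' := fun g g' => Chom.ext fun f => dual_ext fun n v => by
        rw [map_add, LinearMap.add_apply, Finsupp.add_apply, map_add, LinearMap.add_apply,
          dualChom_apply, dualChom_apply, dualChom_apply, dualPoly_add_left,
          Polynomial.coeff_add]
      map_smul' := fun c g => Chom.ext fun f => dual_ext fun n v => by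
        rw [RingHom.id_apply, map_smul, LinearMap.smul_apply, Finsupp.smul_apply, map_smul,
          LinearMap.smul_apply]
        rw [dualChom_apply, dualChom_apply, dualPoly_smul_left, Polynomial.coeff_smul] }
    fun g => Chom.ext fun f => dual_ext fun n v => by
      change pair (dualChom (del k _ g) f n) v = pair ((del k (Chom k _ _) (dualChom g)) f n) v
      rw [Chom.del_apply, Finsupp.neg_apply, map_neg, LinearMap.neg_apply,
        lam_coeff_dual _ (dualPoly g f v) v fun n => dualChom_apply g f n v,
        dualChom_apply, dualPoly_del_left, Polynomial.coeff_neg]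

/-- The defining property of the dual action, at scalars. -/
theorem pair_ev_dual (g : Chom k M M) (f : CDual k M) (v : M) (s u : k) :
    (pair (ev s (dualCend k M g f)) v).eval u = -(pair f (ev s (g v))).eval (u - s) := by
  have h1 : ∀ P : VPoly (CDual k M), ∀ B : k[X][X], (∀ n, pair (P n) v = B.coeff n) →
      (pair (ev s P) v).eval u = (B.eval (Polynomial.C s)).eval u := by
    intro P B h
    have hB : ∀ P : VPoly (CDual k M), pair (ev s P) v =
        (subst (LinearMap.mulLeft k (Polynomial.X : k[X][X]))
          ((Algebra.linearMap k[X] k[X][X]).restrictScalars k ∘ₗ pair.flip v) P).eval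
            (Polynomial.C s) := by
      intro P
      induction P using Finsupp.induction_linear with
      | zero => simp
      | add p q hp hq => simp only [map_add, LinearMap.add_apply, hp, hq, Polynomial.eval_add]
      | single n f =>
        simp [ev, subst_single, LinearMap.pow_mulLeft, smul_pow, Polynomial.smul_eq_C_mul]
        ring
    rw [hB]
    congr 2
    ext1 n
    rw [← h]
    clear h hB
    induction P using Finsupp.induction_linear with
    | zero => simp
    | add p q hp hq =>
      simp only [map_add, LinearMap.add_apply, hp, hq, Polynomial.coeff_add, Finsupp.add_apply]
    | single m f =>
      simp only [subst_single, LinearMap.pow_mulLeft, LinearMap.comp_apply,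
        LinearMap.mulLeft_apply, LinearMap.restrictScalars_apply, Algebra.linearMap_apply,
        Polynomial.algebraMap_eq, LinearMap.flip_apply]
      rw [mul_comm, Polynomial.coeff_C_mul_X_pow]
      by_cases hmn : n = m
      · simp [hmn]
      · rw [if_neg hmn, Finsupp.single_apply, if_neg (Ne.symm hmn), map_zero,
          LinearMap.zero_apply]
  rw [h1 (dualCend k M g f) (dualPoly g f v) fun n => dualChom_apply g f n v]
  have h2 : ∀ p : VPoly M,
      ((subst (LinearMap.mulLeft k (Polynomial.X : k[X][X]))
        ((Polynomial.aeval (Polynomial.C Polynomial.X - Polynomial.X : k[X][X])).toLinearMap ∘ₗ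
        pair f) p).eval (Polynomial.C s)).eval u = (pair f (ev s p)).eval (u - s) := by
    intro p
    induction p using Finsupp.induction_linear with
    | zero => simp
    | add p q hp hq => simp only [map_add, hp, hq, Polynomial.eval_add]
    | single n w =>
      have h3 : ∀ q : k[X], ((Polynomial.aeval
          (Polynomial.C Polynomial.X - Polynomial.X : k[X][X]) q).eval
            (Polynomial.C s)).eval u = q.eval (u - s) := by
        intro q
        induction q using Polynomial.induction_on' with
        | add p q hp hq => simp only [map_add, hp, hq, Polynomial.eval_add]
        | monomial n c =>
          simp [Polynomial.aeval_monomial, Polynomial.algebraMap_apply]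
      simp [subst_single, LinearMap.pow_mulLeft, ev, smul_pow, h3]
  rw [← h2 (g v)]
  have h4 : dualPoly g f v = -(subst (LinearMap.mulLeft k (Polynomial.X : k[X][X]))
        ((Polynomial.aeval (Polynomial.C Polynomial.X - Polynomial.X : k[X][X])).toLinearMap ∘ₗ
        pair f) (g v)) := rfl
  rw [h4, Polynomial.eval_neg, Polynomial.eval_neg]

end DualAction

/-! ## Representations -/

/-- A representation `(M, l, r)` of a Leibniz conformal algebra; `l a v` is `l(a)_λ v`. -/
structure Representation {k : Type*} [Field k] {Q : Type*} [AddCommGroup Q] [Module k Q]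
    [Module k[X] Q] [IsScalarTower k k[X] Q] (L : LeibnizConformalAlgebra k Q)
    (M : Type*) [AddCommGroup M] [Module k M] [Module k[X] M] [IsScalarTower k k[X] M] where
  /-- the left action `l : Q → Cend(M)` -/
  l : Q →ₗ[k[X]] Chom k M M
  /-- the right action `r : Q → Cend(M)` -/
  r : Q →ₗ[k[X]] Chom k M M
  /-- `l(a)_λ (l(b)_μ v) = l([a_λ b])_{λ+μ} v + l(b)_μ (l(a)_λ v)` -/
  left_left : ∀ a b v,
    subst (varM k M) (subst (varL k M) (const₂ k M) ∘ₗ (l a).toLin) (l b v) =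
      subst (varL k M) (subst (varL k M + varM k M) (const₂ k M) ∘ₗ
          Chom.toLin.flip v ∘ₗ l.restrictScalars k) (L.bracket a b) +
        subst (varL k M) (subst (varM k M) (const₂ k M) ∘ₗ (l b).toLin) (l a v)
  /-- `l(a)_λ (r(b)_{-μ-∂} v) = r(b)_{-λ-μ-∂} (l(a)_λ v) + r([a_λ b])_{-μ-∂} v` -/
  left_right : ∀ a b v,
    subst (varM k M) (subst (varL k M) (const₂ k M) ∘ₗ (l a).toLin) (skew k M (r b v)) =
      subst (varL k M) (subst (-varL k M - varM k M - del k (VPoly₂ M)) (const₂ k M) ∘ₗ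
          (r b).toLin) (l a v) +
        subst (varL k M) (subst (-varM k M - del k (VPoly₂ M)) (const₂ k M) ∘ₗ
          Chom.toLin.flip v ∘ₗ r.restrictScalars k) (L.bracket a b)
  /-- `r(b)_{-λ-μ-∂} (r(a)_{-μ-∂} v) = -r(b)_{-λ-μ-∂} (l(a)_λ v)` -/
  right_right : ∀ a b v,
    subst (varM k M) (subst (-varL k M - varM k M - del k (VPoly₂ M)) (const₂ k M) ∘ₗ
        (r b).toLin) (skew k M (r a v)) =
      -subst (varL k M) (subst (-varL k M - varM k M - del k (VPoly₂ M)) (const₂ k M) ∘ₗ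
        (r b).toLin) (l a v)

/-! ### The identities at scalars -/

section Scalars

variable {k : Type*} [Field k]
  {Q : Type*} [AddCommGroup Q] [Module k Q] [Module k[X] Q] [IsScalarTower k k[X] Q]
  {M : Type*} [AddCommGroup M] [Module k M] [Module k[X] M] [IsScalarTower k k[X] M]

theorem evS_lam (s : k) (p : VPoly M) :
    evS s (lam k M p) = -(s • evS s p) - del k M (evS s p) := by
  rw [evS, subst_lam]; simp

theorem evS_del (s : k) (p : VPoly M) : evS s (del k (VPoly M) p) = del k M (evS s p) := by
  rw [evS, map_subst (del k M) _ (-(s • 1) - del k M) (by simp), del_eq_mapRange]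
  induction p using Finsupp.induction_linear with
  | zero => simp
  | add p q hp hq => simp only [map_add, hp, hq]
  | single n v => simp [subst_single]

/-- A functional on which `∂` acts by the scalar `c` turns `p(-s-∂)` into `p(-s-c)`. -/
theorem map_evS {Z : Type*} [AddCommGroup Z] [Module k Z] (ψ : M →ₗ[k] Z) (c s : k)
    (h : ∀ w, ψ (del k M w) = c • ψ w) (p : VPoly M) : ψ (evS s p) = ψ (ev (-s - c) p) := by
  rw [evS, map_subst ψ _ ((-s - c) • 1) (fun w => by simp [h, sub_smul]), subst_scalar]
  rfl

theorem lin_map_del (l : Q →ₗ[k[X]] Chom k M M) (a : Q) :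
    l (del k Q a) = del k (Chom k M M) (l a) := map_smul l _ a

theorem lin_ev (l : Q →ₗ[k[X]] Chom k M M) (v : M) (c : k) (p : VPoly Q) :
    (Chom.toLin.flip v ∘ₗ l.restrictScalars k) (ev c p) = l (ev c p) v := rfl

variable (s t : k)

theorem ev_chom_del (g : Chom k M M) (v : M) :
    ev s (g (del k M v)) = s • ev s (g v) + del k M (ev s (g v)) := by
  rw [g.map_del, LinearMap.add_apply, map_add, ev_lam, ev_del]

theorem jacobi_left (b : Q →ₗ[k] Q →ₗ[k] VPoly Q) (x y z : Q) :
    ev₂ s t (subst (varM k Q) (subst (varL k Q) (const₂ k Q) ∘ₗ b x) (b y z)) =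
      ev s (b x (ev t (b y z))) := by
  rw [ev₂_subst s t t _ (ev₂_varM s t), LinearMap.comp_apply,
    ev₂_subst_const s t s _ (ev₂_varL s t)]

theorem jacobi_right (b : Q →ₗ[k] Q →ₗ[k] VPoly Q) (x y z : Q) :
    ev₂ s t (subst (varL k Q) (subst (varL k Q + varM k Q) (const₂ k Q) ∘ₗ b.flip z)
          (b x y) +
        subst (varL k Q) (subst (varM k Q) (const₂ k Q) ∘ₗ b y) (b x z)) =
      ev (s + t) (b (ev s (b x y)) z) + ev t (b y (ev s (b x z))) := by
  rw [map_add, ev₂_subst s t s _ (ev₂_varL s t), ev₂_subst s t s _ (ev₂_varL s t),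
    LinearMap.comp_apply, LinearMap.comp_apply, ev₂_subst_const s t (s + t),
    ev₂_subst_const s t t _ (ev₂_varM s t), LinearMap.flip_apply]
  intro w
  rw [LinearMap.add_apply, map_add, ev₂_varL, ev₂_varM, add_smul]

theorem eval_ll (g : Chom k M M) (p : VPoly M) :
    ev₂ s t (subst (varM k M) (subst (varL k M) (const₂ k M) ∘ₗ g.toLin) p) =
      ev s (g (ev t p)) := by
  rw [ev₂_subst s t t _ (ev₂_varM s t), LinearMap.comp_apply,
    ev₂_subst_const s t s _ (ev₂_varL s t)]

theorem eval_ll' (g : Chom k M M) (p : VPoly M) :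
    ev₂ s t (subst (varL k M) (subst (varM k M) (const₂ k M) ∘ₗ g.toLin) p) =
      ev t (g (ev s p)) := by
  rw [ev₂_subst s t s _ (ev₂_varL s t), LinearMap.comp_apply,
    ev₂_subst_const s t t _ (ev₂_varM s t)]

theorem eval_bl (l : Q →ₗ[k[X]] Chom k M M) (v : M) (p : VPoly Q) :
    ev₂ s t (subst (varL k M) (subst (varL k M + varM k M) (const₂ k M) ∘ₗ
          Chom.toLin.flip v ∘ₗ l.restrictScalars k) p) = ev (s + t) (l (ev s p) v) := by
  rw [ev₂_subst s t s _ (ev₂_varL s t), LinearMap.comp_apply, ev₂_subst_const s t (s + t)]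
  · rfl
  intro w
  rw [LinearMap.add_apply, map_add, ev₂_varL, ev₂_varM, add_smul]

theorem evD_lm (w : VPoly₂ M) :
    ev₂ s t ((-varL k M - varM k M - del k (VPoly₂ M)) w) =
      -((s + t) • ev₂ s t w) - del k M (ev₂ s t w) := by
  simp only [LinearMap.sub_apply, LinearMap.neg_apply, map_sub, map_neg, ev₂_varL, ev₂_varM,
    ev₂_del, add_smul]
  abel

theorem evD_m (w : VPoly₂ M) :
    ev₂ s t ((-varM k M - del k (VPoly₂ M)) w) =
      -(t • ev₂ s t w) - del k M (ev₂ s t w) := by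
  simp only [LinearMap.sub_apply, LinearMap.neg_apply, map_sub, map_neg, ev₂_varM, ev₂_del]

theorem eval_rl (g : Chom k M M) (p : VPoly M) :
    ev₂ s t (subst (varL k M) (subst (-varL k M - varM k M - del k (VPoly₂ M)) (const₂ k M) ∘ₗ
          g.toLin) p) = evS (s + t) (g (ev s p)) := by
  rw [ev₂_subst s t s _ (ev₂_varL s t), LinearMap.comp_apply,
    ev₂_subst_const_del s t (s + t) _ (evD_lm s t)]

theorem eval_rr (g : Chom k M M) (p : VPoly M) :
    ev₂ s t (subst (varM k M) (subst (-varL k M - varM k M - del k (VPoly₂ M)) (const₂ k M) ∘ₗ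
          g.toLin) p) = evS (s + t) (g (ev t p)) := by
  rw [ev₂_subst s t t _ (ev₂_varM s t), LinearMap.comp_apply,
    ev₂_subst_const_del s t (s + t) _ (evD_lm s t)]

theorem eval_br (l : Q →ₗ[k[X]] Chom k M M) (v : M) (p : VPoly Q) :
    ev₂ s t (subst (varL k M) (subst (-varM k M - del k (VPoly₂ M)) (const₂ k M) ∘ₗ
          Chom.toLin.flip v ∘ₗ l.restrictScalars k) p) = evS t (l (ev s p) v) := by
  rw [ev₂_subst s t s _ (ev₂_varL s t), LinearMap.comp_apply,
    ev₂_subst_const_del s t t _ (evD_m s t)]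
  rfl

variable {L : LeibnizConformalAlgebra k Q} (ρ : Representation L M)

theorem LeibnizConformalAlgebra.jacobi_ev (L : LeibnizConformalAlgebra k Q) (a b c : Q) :
    ev s (L.bracket a (ev t (L.bracket b c))) =
      ev (s + t) (L.bracket (ev s (L.bracket a b)) c) +
        ev t (L.bracket b (ev s (L.bracket a c))) := by
  rw [← jacobi_left, L.jacobi, jacobi_right]

namespace Representation

theorem left_left_ev (a b : Q) (v : M) :
    ev s (ρ.l a (ev t (ρ.l b v))) =
      ev (s + t) (ρ.l (ev s (L.bracket a b)) v) + ev t (ρ.l b (ev s (ρ.l a v))) := by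
  rw [← eval_ll, ρ.left_left, map_add, eval_bl, eval_ll']

theorem left_right_ev (a b : Q) (v : M) :
    ev s (ρ.l a (evS t (ρ.r b v))) =
      evS (s + t) (ρ.r b (ev s (ρ.l a v))) + evS t (ρ.r (ev s (L.bracket a b)) v) := by
  rw [← ev_skew, ← eval_ll, ρ.left_right, map_add, eval_rl, eval_br]

theorem right_right_ev (a b : Q) (v : M) :
    evS (s + t) (ρ.r b (evS t (ρ.r a v))) = -evS (s + t) (ρ.r b (ev s (ρ.l a v))) := by
  rw [← ev_skew t, ← eval_rr, ρ.right_right, map_neg, eval_rl]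

end Representation

theorem del_prod (x : Q × M) : del k (Q × M) x = (del k Q x.1, del k M x.2) := rfl

/-- The functional `w ↦ ⟨f, w⟩_u`. -/
def pairAt (f : CDual k M) (u : k) : M →ₗ[k] k := Polynomial.leval u ∘ₗ pair f

theorem pairAt_apply (f : CDual k M) (u : k) (w : M) : pairAt f u w = (pair f w).eval u := rfl

theorem pairAt_del (f : CDual k M) (u : k) (w : M) :
    pairAt f u (del k M w) = u • pairAt f u w := by
  simp [pairAt, pair_del]

theorem pair_evS (P : VPoly (CDual k M)) (v : M) (s u : k) :
    (pair (evS s P) v).eval u = (pair (ev (u - s) P) v).eval u := by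
  have := map_evS (Polynomial.leval u ∘ₗ pair.flip v : CDual k M →ₗ[k] k) (-u) s
    (fun f => by simp [pair_del_left]) P
  rw [show -s - -u = u - s by ring] at this
  exact this


theorem pairAt_add (f g : CDual k M) (u : k) (v : M) :
    pairAt (f + g) u v = pairAt f u v + pairAt g u v := by
  simp [pairAt_apply]

theorem pairAt_neg (f : CDual k M) (u : k) (v : M) : pairAt (-f) u v = -pairAt f u v := by
  simp [pairAt_apply]

theorem pairAt_evS (P : VPoly (CDual k M)) (v : M) (s u : k) :
    pairAt (evS s P) u v = pairAt (ev (u - s) P) u v :=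
  pair_evS P v s u

theorem Representation.pairAt_left_right (ρ : Representation L M) (f : CDual k M) (t s w : k)
    (a b : Q) (v : M) :
    pairAt f t (ev s (ρ.l a (ev w (ρ.r b v)))) =
      pairAt f t (ev w (ρ.r b (ev s (ρ.l a v)))) +
        pairAt f t (ev (s + w) (ρ.r (ev s (L.bracket a b)) v)) := by
  have h := congrArg (pairAt f t) (ρ.left_right_ev s (-w - s - t) a b v)
  have h' := map_evS (pairAt f t ∘ₗ ev s ∘ₗ (ρ.l a).toLin) (s + t) (-w - s - t)
    (fun x => by
      simp only [LinearMap.comp_apply, ev_chom_del, map_add, map_smul, pairAt_del, add_smul])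
    (ρ.r b v)
  simp only [LinearMap.comp_apply] at h'
  rw [map_add, h', map_evS (pairAt f t) t _ (pairAt_del f t),
    map_evS (pairAt f t) t _ (pairAt_del f t)] at h
  rw [show -(-w - s - t) - (s + t) = w by ring, show -(s + (-w - s - t)) - t = w by ring,
    show -(-w - s - t) - t = s + w by ring] at h
  exact h

theorem Representation.pairAt_right_right (ρ : Representation L M) (f : CDual k M) (u s y : k)
    (a b : Q) (v : M) :
    pairAt f u (ev y (ρ.r b (ev s (ρ.r a v)))) =
      -pairAt f u (ev y (ρ.r b (ev s (ρ.l a v)))) := by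
  have h := congrArg (pairAt f u) (ρ.right_right_ev s (-s - u - y) a b v)
  rw [map_neg, map_evS (pairAt f u) u _ (pairAt_del f u),
    map_evS (pairAt f u) u _ (pairAt_del f u), show -(s + (-s - u - y)) - u = y by ring] at h
  have h' := map_evS (pairAt f u ∘ₗ ev y ∘ₗ (ρ.r b).toLin) (y + u) (-s - u - y)
    (fun x => by
      simp only [LinearMap.comp_apply, ev_chom_del, map_add, map_smul, pairAt_del, add_smul])
    (ρ.r a v)
  simp only [LinearMap.comp_apply] at h'
  rw [h', show -(-s - u - y) - (y + u) = s by ring] at h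
  exact h

/-- The `λ`-bracket `[(a + x)_λ (b + y)] = [a_λ b] + l(a)_λ y + r(b)_{-λ-∂} x` on `Q ⊕ M`. -/
def Representation.semidirectBracket (ρ : Representation L M) :
    (Q × M) →ₗ[k] (Q × M) →ₗ[k] VPoly (Q × M) :=
  LinearMap.mk₂ k
    (fun x y => Finsupp.mapRange.linearMap (LinearMap.inl k Q M) (L.bracket x.1 y.1) +
      Finsupp.mapRange.linearMap (LinearMap.inr k Q M)
        (ρ.l x.1 y.2 + skew k M (ρ.r y.1 x.2)))
    (fun x x' y => by
      simp only [Prod.fst_add, Prod.snd_add, map_add, LinearMap.add_apply]; abel)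
    (fun c x y => by
      simp only [Prod.smul_fst, Prod.smul_snd, map_smul, LinearMap.smul_apply, smul_add, map_add,
        LinearMap.map_smul_of_tower])
    (fun x y y' => by
      simp only [Prod.fst_add, Prod.snd_add, map_add, LinearMap.add_apply]; abel)
    (fun c x y => by
      simp only [Prod.smul_fst, Prod.smul_snd, map_smul, LinearMap.smul_apply, smul_add, map_add,
        LinearMap.map_smul_of_tower])

theorem Representation.ev_semidirectBracket (ρ : Representation L M) (s : k) (x y : Q × M) :
    ev s (ρ.semidirectBracket x y) =
      (ev s (L.bracket x.1 y.1), ev s (ρ.l x.1 y.2) + evS s (ρ.r y.1 x.2)) := by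
  simp only [semidirectBracket, LinearMap.mk₂_apply, map_add, ev_mapRange, ev_skew]
  simp

end Scalars

/-! ## Dual representations and semidirect products -/

section Constructions

variable {k : Type*} [Field k] [CharZero k]
  {Q : Type*} [AddCommGroup Q] [Module k Q] [Module k[X] Q] [IsScalarTower k k[X] Q]
  {M : Type*} [AddCommGroup M] [Module k M] [Module k[X] M] [IsScalarTower k k[X] M]
  {L : LeibnizConformalAlgebra k Q}

/-- Elements of the dual are determined by the values of the pairing at scalars. -/
theorem cdual_ext {f g : CDual k M} (h : ∀ v (u : k), (pair f v).eval u = (pair g v).eval u) :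
    f = g :=
  CDual.ext fun v => Polynomial.funext (h v)

/-- The semidirect product Leibniz conformal algebra `Q ⋉_{l,r} M`. -/
def Representation.semidirect (ρ : Representation L M) : LeibnizConformalAlgebra k (Q × M) where
  bracket := ρ.semidirectBracket
  del_left x y := vpoly_ext (k := k) fun s => by
    rw [map_neg, ev_lam, ρ.ev_semidirectBracket, ρ.ev_semidirectBracket, del_prod]
    simp only [L.del_left, lin_map_del, Chom.del_apply, Chom.map_del, map_neg, ev_lam, evS_lam,
      LinearMap.add_apply, map_add, evS_del]
    ext
    · simp
    · simp; abel
  del_right x y := vpoly_ext (k := k) fun s => by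
    rw [LinearMap.add_apply, map_add, ev_lam, ev_del, ρ.ev_semidirectBracket,
      ρ.ev_semidirectBracket, del_prod, del_prod]
    simp only [L.del_right, lin_map_del, Chom.del_apply, Chom.map_del, map_neg, ev_lam, evS_lam,
      LinearMap.add_apply, map_add, ev_del]
    ext
    · simp
    · simp; abel
  jacobi x y z := vpoly₂_ext (k := k) fun s t => by
    rw [jacobi_left, jacobi_right]
    simp only [ρ.ev_semidirectBracket, L.jacobi_ev s t, Prod.mk_add_mk]
    congr 1
    have h1 := ρ.left_left_ev s t x.1 y.1 z.2
    have h2 := ρ.left_right_ev s t x.1 z.1 y.2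
    have h3 := ρ.left_right_ev t s y.1 z.1 x.2
    have h4 := ρ.right_right_ev t s y.1 z.1 x.2
    rw [add_comm t s] at h3 h4
    simp only [map_add]
    rw [h1, h2, h3, h4]
    abel

variable [Module.Finite k[X] M]

theorem pairAt_dual (g : Chom k M M) (f : CDual k M) (v : M) (s u : k) :
    pairAt (ev s (dualCend k M g f)) u v = -pairAt f (u - s) (ev s (g v)) :=
  pair_ev_dual g f v s u

/-- The right action `-l^* - r^*` of the dual representation. -/
def Representation.dualRight (ρ : Representation L M) :
    Q →ₗ[k[X]] Chom k (CDual k M) (CDual k M) :=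
  -(dualCend k M ∘ₗ ρ.l) - dualCend k M ∘ₗ ρ.r

theorem Representation.pairAt_dualRight (ρ : Representation L M) (b : Q) (f : CDual k M) (v : M)
    (s u : k) : pairAt (ev s (ρ.dualRight b f)) u v =
      pairAt f (u - s) (ev s (ρ.l b v)) + pairAt f (u - s) (ev s (ρ.r b v)) := by
  have : ρ.dualRight b f = -(dualCend k M (ρ.l b) f) + -(dualCend k M (ρ.r b) f) := by
    rw [← sub_eq_add_neg]; rfl
  rw [this, map_add, map_neg, map_neg, pairAt_add, pairAt_neg, pairAt_neg, pairAt_dual,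
    pairAt_dual, neg_neg, neg_neg]

/-- The dual representation `(M^{*c}, l^*, -l^* - r^*)`. -/
def Representation.dual (ρ : Representation L M) : Representation L (CDual k M) where
  l := dualCend k M ∘ₗ ρ.l
  r := ρ.dualRight
  left_left a b f := vpoly₂_ext (k := k) fun s t => cdual_ext fun v u => by
    rw [eval_ll, map_add, eval_bl, eval_ll', ← pairAt_apply, ← pairAt_apply, pairAt_add]
    simp only [LinearMap.comp_apply, pairAt_dual]
    have h := congrArg (pairAt f (u - s - t)) (ρ.left_left_ev s t a b v)
    rw [map_add] at h
    rw [show u - (s + t) = u - s - t by ring, show u - t - s = u - s - t by ring, h]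
    ring
  left_right a b f := vpoly₂_ext (k := k) fun s t => cdual_ext fun v u => by
    rw [eval_ll, map_add, eval_rl, eval_br, ev_skew, ← pairAt_apply, ← pairAt_apply, pairAt_add]
    simp only [LinearMap.comp_apply, pairAt_dual, pairAt_evS, Representation.pairAt_dualRight]
    rw [show u - s - (u - s - t) = t by ring, show u - (u - (s + t)) - s = t by ring,
      show u - (u - t) = t by ring, show u - (s + t) = u - s - t by ring]
    have h1 := congrArg (pairAt f t) (ρ.left_left_ev s (u - s - t) a b v)
    have h2 := ρ.pairAt_left_right f t s (u - s - t) a b v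
    rw [map_add, show s + (u - s - t) = u - t by ring] at h1
    rw [show s + (u - s - t) = u - t by ring] at h2
    rw [h1, h2]
    ring
  right_right a b f := vpoly₂_ext (k := k) fun s t => cdual_ext fun v u => by
    rw [eval_rr, map_neg, eval_rl, ev_skew, ← pairAt_apply, ← pairAt_apply, pairAt_neg]
    simp only [LinearMap.comp_apply, pairAt_dual, pairAt_evS, Representation.pairAt_dualRight]
    rw [show u - (u - (s + t)) - s = t by ring, show u - (u - (s + t)) - t = s by ring,
      show u - (u - (s + t)) - s = t by ring,
      ρ.pairAt_right_right f t (u - (s + t)) s b a v]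
    ring

end Constructions

/-! ## The isomorphism `M^{*c} ⊗ Q ≅ Chom(M, Q)` -/

section Eta

variable {k : Type*} [Field k]
  {M : Type*} [AddCommGroup M] [Module k M] [Module k[X] M] [IsScalarTower k k[X] M]
  {Q : Type*} [AddCommGroup Q] [Module k Q] [Module k[X] Q] [IsScalarTower k k[X] Q]

/-- `v ↦ ⟨f, v⟩_{λ+∂} a`, a conformal linear map `M → Q[λ]`. -/
def rankOne (f : CDual k M) (a : Q) : Chom k M Q :=
  ⟨{ toFun := fun v => Polynomial.aeval (lam k Q + del k (VPoly Q)) (pair f v) (const k Q a)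
     map_add' := fun v w => by simp only [map_add, LinearMap.add_apply]
     map_smul' := fun c v => by simp only [map_smul, LinearMap.smul_apply, RingHom.id_apply] },
   fun v => by
    change Polynomial.aeval (lam k Q + del k (VPoly Q)) (pair f (del k M v)) (const k Q a) = _
    rw [pair_del, map_mul, Polynomial.aeval_X]; rfl⟩

theorem rankOne_apply (f : CDual k M) (a : Q) (v : M) :
    rankOne f a v =
      Polynomial.aeval (lam k Q + del k (VPoly Q)) (pair f v) (const k Q a) := rfl

variable (k M Q) in
/-- `φ : M^{*c} ⊗ Q → Chom(M, Q)`, `φ(f ⊗ a)_λ v = ⟨f, v⟩_{λ+∂} a`, where `∂` acts on `Q`. -/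
def phi : CDual k M ⊗[k] Q →ₗ[k] Chom k M Q :=
  TensorProduct.lift (LinearMap.mk₂ k rankOne
    (fun f g a => Chom.ext fun v => by
      rw [map_add, LinearMap.add_apply, rankOne_apply, rankOne_apply, rankOne_apply, map_add,
        LinearMap.add_apply, map_add, LinearMap.add_apply])
    (fun c f a => Chom.ext fun v => by
      rw [map_smul, LinearMap.smul_apply, rankOne_apply, rankOne_apply, map_smul,
        LinearMap.smul_apply, map_smul, LinearMap.smul_apply])
    (fun f a b => Chom.ext fun v => by
      rw [map_add, LinearMap.add_apply, rankOne_apply, rankOne_apply, rankOne_apply, map_add,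
        map_add])
    (fun c f a => Chom.ext fun v => by
      rw [map_smul, LinearMap.smul_apply, rankOne_apply, rankOne_apply, map_smul, map_smul]))

theorem phi_tmul (f : CDual k M) (a : Q) (v : M) :
    phi k M Q (f ⊗ₜ a) v =
      Polynomial.aeval (lam k Q + del k (VPoly Q)) (pair f v) (const k Q a) := rfl

theorem map_aeval {W Z : Type*} [AddCommGroup W] [Module k W] [AddCommGroup Z] [Module k Z]
    (g : W →ₗ[k] Z) (D : Module.End k W) (D' : Module.End k Z) (h : ∀ w, g (D w) = D' (g w))
    (p : k[X]) (w : W) : g (Polynomial.aeval D p w) = Polynomial.aeval D' p (g w) := by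
  induction p using Polynomial.induction_on' with
  | add p q hp hq => simp only [map_add, LinearMap.add_apply, hp, hq]
  | monomial n c =>
    rw [← mul_one c, ← smul_eq_mul, ← Polynomial.smul_monomial, ← Polynomial.X_pow_eq_monomial,
      map_smul, map_smul, LinearMap.smul_apply, LinearMap.smul_apply, map_smul]
    congr 1
    induction n generalizing w with
    | zero => simp
    | succ n ih =>
      rw [pow_succ, map_mul, map_mul, Polynomial.aeval_X, Polynomial.aeval_X,
        Module.End.mul_apply, Module.End.mul_apply, ih, h]

theorem aeval_del (p : k[X]) (v : M) : Polynomial.aeval (del k M) p v = p • v := by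
  induction p using Polynomial.induction_on' with
  | add p q hp hq => simp only [map_add, LinearMap.add_apply, hp, hq, add_smul]
  | monomial n c =>
    rw [← mul_one c, ← smul_eq_mul, ← Polynomial.smul_monomial, ← Polynomial.X_pow_eq_monomial,
      map_smul, LinearMap.smul_apply, smul_assoc]
    congr 1
    induction n generalizing v with
    | zero => simp
    | succ n ih =>
      rw [pow_succ, map_mul, Polynomial.aeval_X, Module.End.mul_apply, ih, mul_smul]
      rfl

/-- A conformal linear map is determined by its values on a `k[∂]`-basis. -/
theorem Chom.ext_basis {ι : Type*} (b : Module.Basis ι k[X] M) {S T : Chom k M Q}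
    (h : ∀ i, S (b i) = T (b i)) : S = T := by
  refine Chom.ext fun v => ?_
  have hv : v ∈ Submodule.span k[X] (Set.range b) := b.span_eq ▸ Submodule.mem_top
  induction hv using Submodule.span_induction with
  | mem x hx => obtain ⟨i, rfl⟩ := hx; exact h i
  | zero => simp
  | add x y _ _ hx hy => simp only [map_add, hx, hy]
  | smul p x _ hx =>
    rw [← aeval_del, map_aeval S.toLin _ _ S.map_del, map_aeval T.toLin _ _ T.map_del, hx]

/-- The dual basis element `v_i^*`. -/
def dualBasis {ι : Type*} (b : Module.Basis ι k[X] M) (i : ι) : CDual k M :=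
  CDual.mk ((b.coord i).restrictScalars k) fun v => (b.coord i).map_smul Polynomial.X v

variable (k M Q) in
/-- `-∂ ⊗ 1 - 1 ⊗ ∂` on `M^{*c} ⊗ Q`. -/
def negDel₂ : Module.End k (CDual k M ⊗[k] Q) :=
  -(LinearMap.rTensor Q (del k (CDual k M)) + LinearMap.lTensor (CDual k M) (del k Q))

/-- The candidate inverse of `φ` in terms of a basis. -/
def psi {ι : Type*} [Fintype ι] (b : Module.Basis ι k[X] M) :
    Chom k M Q →ₗ[k] CDual k M ⊗[k] Q :=
  ∑ i, subst (negDel₂ k M Q) (TensorProduct.mk k (CDual k M) Q (dualBasis b i)) ∘ₗ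
    Chom.toLin.flip (b i)

theorem pair_dualBasis {ι : Type*} [DecidableEq ι] (b : Module.Basis ι k[X] M) (i j : ι) :
    pair (dualBasis b i) (b j) = if i = j then 1 else 0 := by
  change b.repr (b j) i = _
  rw [b.repr_self, Finsupp.single_apply]
  simp only [eq_comm]

theorem phi_negDel₂ (e : CDual k M ⊗[k] Q) (v : M) :
    phi k M Q (negDel₂ k M Q e) v = lam k Q (phi k M Q e v) := by
  induction e using TensorProduct.induction_on with
  | zero => simp
  | add x y hx hy => simp only [map_add, LinearMap.add_apply, hx, hy]
  | tmul f a =>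
    rw [negDel₂, LinearMap.neg_apply, LinearMap.add_apply, LinearMap.rTensor_tmul,
      LinearMap.lTensor_tmul, map_neg, map_add, map_neg, map_add, LinearMap.neg_apply,
      LinearMap.add_apply, phi_tmul, phi_tmul, phi_tmul, pair_del_left, map_neg,
      LinearMap.neg_apply, map_mul, Polynomial.aeval_X, Module.End.mul_apply]
    have hc : const k Q (del k Q a) = del k (VPoly Q) (const k Q a) := by
      simp [const, del]
    rw [hc, ← map_aeval (del k (VPoly Q)) (lam k Q + del k (VPoly Q)) _
      (fun w => by simp [lam_comm_del]), LinearMap.add_apply]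
    abel

theorem phi_psi {ι : Type*} [Fintype ι] (b : Module.Basis ι k[X] M) (T : Chom k M Q) :
    phi k M Q (psi b T) = T := by
  classical
  refine Chom.ext_basis b fun j => ?_
  have h1 : ∀ (i : ι) (p : VPoly Q), phi k M Q (subst (negDel₂ k M Q)
      (TensorProduct.mk k (CDual k M) Q (dualBasis b i)) p) (b j) = if i = j then p else 0 := by
    intro i p
    have := map_subst (Chom.toLin.flip (b j) ∘ₗ phi k M Q) (negDel₂ k M Q) (lam k Q)
      (fun e => phi_negDel₂ e (b j)) (TensorProduct.mk k (CDual k M) Q (dualBasis b i)) p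
    refine this.trans ?_
    clear this
    induction p using Finsupp.induction_linear with
    | zero => simp
    | add p q hp hq => rw [map_add, hp, hq]; split_ifs <;> simp
    | single n v =>
      rw [subst_single]
      have : (Chom.toLin.flip (b j) ∘ₗ phi k M Q) ((TensorProduct.mk k (CDual k M) Q
          (dualBasis b i)) v) = if i = j then const k Q v else 0 := by
        change phi k M Q (dualBasis b i ⊗ₜ v) (b j) = _
        rw [phi_tmul, pair_dualBasis]
        split_ifs <;> simp
      rw [LinearMap.comp_apply, this]
      split_ifs
      · induction n with
        | zero => simp [const]
        | succ n ih => rw [pow_succ', Module.End.mul_apply, ih, lam_single]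
      · simp
  simp only [psi, LinearMap.sum_apply, LinearMap.comp_apply, map_sum, LinearMap.flip_apply, h1]
  simp

theorem psi_phi {ι : Type*} [Fintype ι] (b : Module.Basis ι k[X] M) (e : CDual k M ⊗[k] Q) :
    psi b (phi k M Q e) = e := by
  classical
  induction e using TensorProduct.induction_on with
  | zero => simp
  | add x y hx hy => simp only [map_add, hx, hy]
  | tmul f a =>
    have h1 : ∀ (i : ι) (q : VPoly Q),
        subst (negDel₂ k M Q) (TensorProduct.mk k (CDual k M) Q (dualBasis b i))
          ((lam k Q + del k (VPoly Q)) q) =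
        (-LinearMap.rTensor Q (del k (CDual k M)))
          (subst (negDel₂ k M Q) (TensorProduct.mk k (CDual k M) Q (dualBasis b i)) q) := by
      intro i q
      have hd : subst (negDel₂ k M Q) (TensorProduct.mk k (CDual k M) Q (dualBasis b i))
          (del k (VPoly Q) q) = LinearMap.lTensor (CDual k M) (del k Q)
          (subst (negDel₂ k M Q) (TensorProduct.mk k (CDual k M) Q (dualBasis b i)) q) := by
        rw [map_subst (LinearMap.lTensor (CDual k M) (del k Q)) (negDel₂ k M Q) (negDel₂ k M Q),
          del_eq_mapRange]
        · induction q using Finsupp.induction_linear with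
          | zero => simp
          | add p q hp hq => simp only [map_add, hp, hq]
          | single n v => simp [subst_single]
        · intro w
          induction w using TensorProduct.induction_on with
          | zero => simp
          | add x y hx hy => simp only [map_add, hx, hy]
          | tmul f a => simp [negDel₂]
      rw [LinearMap.add_apply, map_add, hd, subst_lam, negDel₂]
      simp only [LinearMap.neg_apply, LinearMap.add_apply]
      abel
    have h2 : ∀ (p : k[X]) (g : CDual k M),
        Polynomial.aeval (-LinearMap.rTensor Q (del k (CDual k M))) p (g ⊗ₜ[k] a) =
          (Polynomial.aeval (-del k (CDual k M)) p g) ⊗ₜ[k] a := fun p g =>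
      (map_aeval ((TensorProduct.mk k (CDual k M) Q).flip a) (-del k (CDual k M))
        (-LinearMap.rTensor Q (del k (CDual k M)))
        (fun w => by simp) p g).symm
    have h3 : ∀ (p : k[X]) (g : CDual k M) (v : M),
        pair (Polynomial.aeval (-del k (CDual k M)) p g) v = p * pair g v := by
      intro p g v
      refine (map_aeval (pair.flip v) (-del k (CDual k M)) (LinearMap.mulLeft k Polynomial.X)
        (fun w => by simp [pair_del_left]) p g).trans ?_
      rw [LinearMap.flip_apply]
      have : (LinearMap.mulLeft k (Polynomial.X : k[X])) = del k k[X] := rfl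
      rw [this, aeval_del, smul_eq_mul]
    have h4 : ∑ i, Polynomial.aeval (-del k (CDual k M)) (pair f (b i)) (dualBasis b i) = f := by
      have h5 : ∀ g : CDual k M, ∀ (p : k[X]) (v : M), pair g (p • v) = p * pair g v := by
        intro g p v
        rw [← aeval_del, map_aeval (pair g) _ (del k k[X]) (pair_del g), aeval_del, smul_eq_mul]
      refine CDual.ext fun v => ?_
      have hv : v ∈ Submodule.span k[X] (Set.range b) := b.span_eq ▸ Submodule.mem_top
      induction hv using Submodule.span_induction with
      | mem x hx =>
        obtain ⟨j, rfl⟩ := hx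
        simp [h3, pair_dualBasis]
      | zero => simp
      | add x y _ _ hx hy => rw [map_add, map_add, hx, hy]
      | smul p x _ hx => rw [h5, h5, hx]
    conv_rhs => rw [← h4, TensorProduct.sum_tmul]
    rw [psi, LinearMap.sum_apply]
    refine Finset.sum_congr rfl fun i _ => ?_
    rw [LinearMap.comp_apply, LinearMap.flip_apply, phi_tmul, map_aeval _ _ _ (h1 i), ← h2]
    congr 1
    simp [const, subst_single]

variable (k M Q) in
theorem phi_bijective [Module.Finite k[X] M] [Module.Free k[X] M] :
    Function.Bijective (phi k M Q) :=
  Function.bijective_iff_has_inverse.mpr ⟨psi (Module.Free.chooseBasis k[X] M),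
    psi_phi _, phi_psi _⟩

variable (k M Q) in
/-- `η : Chom(M, Q) → M^{*c} ⊗ Q`, the inverse of `φ`. -/
def eta [Module.Finite k[X] M] [Module.Free k[X] M] : Chom k M Q ≃ₗ[k] CDual k M ⊗[k] Q :=
  (LinearEquiv.ofBijective (phi k M Q) (phi_bijective k M Q)).symm

end Eta

/-! ## The classical Leibniz conformal Yang-Baxter equation -/

section YangBaxter

variable {k : Type*} [Field k]
  {P : Type*} [AddCommGroup P] [Module k P] [Module k[X] P] [IsScalarTower k k[X] P]

variable (k P) in
/-- `∂_1 = ∂ ⊗ 1 ⊗ 1`. -/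
def del₁ : Module.End k (P ⊗[k] P ⊗[k] P) :=
  LinearMap.rTensor P (LinearMap.rTensor P (del k P))

variable (k P) in
/-- `∂_2 = 1 ⊗ ∂ ⊗ 1`. -/
def del₂ : Module.End k (P ⊗[k] P ⊗[k] P) :=
  LinearMap.rTensor P (LinearMap.lTensor P (del k P))

variable (k P) in
/-- `∂_3 = 1 ⊗ 1 ⊗ ∂`. -/
def del₃ : Module.End k (P ⊗[k] P ⊗[k] P) :=
  LinearMap.lTensor (P ⊗[k] P) (del k P)

/-- For a linear map `ω` on `P ⊗ (P ⊗ P)`, the map `p ⊗ y ⊗ z ↦ ω(p, y, z)|_{μ = D}`,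
where `p ∈ P[μ]`. -/
def substAt (D : Module.End k (P ⊗[k] P ⊗[k] P))
    (ω : P ⊗[k] (P ⊗[k] P) →ₗ[k] P ⊗[k] P ⊗[k] P) :
    VPoly P ⊗[k] (P ⊗[k] P) →ₗ[k] P ⊗[k] P ⊗[k] P :=
  TensorProduct.lift (Finsupp.lsum k fun n => (TensorProduct.curry ω).compr₂ (D ^ n))

/-- `a ⊗ b ⊗ c ⊗ d ↦ ω([a_μ b], c, d)|_{μ = D}`. -/
def bracketAt (L : LeibnizConformalAlgebra k P) (D : Module.End k (P ⊗[k] P ⊗[k] P))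
    (ω : P ⊗[k] (P ⊗[k] P) →ₗ[k] P ⊗[k] P ⊗[k] P) :
    (P ⊗[k] P) ⊗[k] (P ⊗[k] P) →ₗ[k] P ⊗[k] P ⊗[k] P :=
  substAt D ω ∘ₗ LinearMap.rTensor (P ⊗[k] P) (TensorProduct.lift L.bracket)

variable (k P) in
/-- `x ⊗ (y ⊗ z) ↦ x ⊗ y ⊗ z`. -/
def slot₁ : P ⊗[k] (P ⊗[k] P) →ₗ[k] P ⊗[k] P ⊗[k] P :=
  (TensorProduct.assoc k P P P).symm.toLinearMap

variable (k P) in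
/-- `x ⊗ (y ⊗ z) ↦ y ⊗ x ⊗ z`. -/
def slot₂ : P ⊗[k] (P ⊗[k] P) →ₗ[k] P ⊗[k] P ⊗[k] P :=
  LinearMap.rTensor P (TensorProduct.comm k P P).toLinearMap ∘ₗ slot₁ k P

variable (k P) in
/-- `x ⊗ (y ⊗ z) ↦ y ⊗ z ⊗ x`. -/
def slot₃ : P ⊗[k] (P ⊗[k] P) →ₗ[k] P ⊗[k] P ⊗[k] P :=
  (TensorProduct.comm k P (P ⊗[k] P)).toLinearMap

variable (k P) in
/-- `(a ⊗ b) ⊗ (c ⊗ d) ↦ (a ⊗ c) ⊗ (b ⊗ d)`. -/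
def swapMid : (P ⊗[k] P) ⊗[k] (P ⊗[k] P) →ₗ[k] (P ⊗[k] P) ⊗[k] (P ⊗[k] P) :=
  (TensorProduct.tensorTensorTensorComm k P P P P).toLinearMap

variable (k P) in
/-- `(a ⊗ b) ⊗ e ↦ (b ⊗ a) ⊗ e`. -/
def swapFst : (P ⊗[k] P) ⊗[k] (P ⊗[k] P) →ₗ[k] (P ⊗[k] P) ⊗[k] (P ⊗[k] P) :=
  LinearMap.rTensor (P ⊗[k] P) (TensorProduct.comm k P P).toLinearMap

/-- For `r = ∑ a_i ⊗ b_i`, the element `[[r, r]]` of `P ⊗ P ⊗ P`: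
`∑ [a_i_μ a_j] ⊗ b_i ⊗ b_j |_{μ = ∂_2} + ∑ a_i ⊗ a_j ⊗ [b_j_μ b_i] |_{μ = ∂_2}
- ∑ a_i ⊗ [b_i_μ a_j] ⊗ b_j |_{μ = ∂_1} - ∑ a_i ⊗ [a_j_μ b_i] ⊗ b_j |_{μ = -∂_1-∂_2}`. -/
def yangBaxter (L : LeibnizConformalAlgebra k P) (r : P ⊗[k] P) : P ⊗[k] P ⊗[k] P :=
  bracketAt L (del₂ k P) (slot₁ k P) (swapMid k P (r ⊗ₜ r)) +
    bracketAt L (del₂ k P) (slot₃ k P)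
      (swapFst k P (TensorProduct.comm k _ _ (swapMid k P (r ⊗ₜ r)))) -
    bracketAt L (del₁ k P) (slot₂ k P) (swapMid k P (swapFst k P (r ⊗ₜ r))) -
    bracketAt L (-del₁ k P - del₂ k P) (slot₂ k P)
      (swapFst k P (swapMid k P (swapFst k P (r ⊗ₜ r))))

theorem bracketAt_tmul (L : LeibnizConformalAlgebra k P) (D : Module.End k (P ⊗[k] P ⊗[k] P))
    (ω : P ⊗[k] (P ⊗[k] P) →ₗ[k] P ⊗[k] P ⊗[k] P) (a b c d : P) :
    bracketAt L D ω ((a ⊗ₜ b) ⊗ₜ (c ⊗ₜ d)) =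
      (L.bracket a b).sum fun n x => (D ^ n) (ω (x ⊗ₜ (c ⊗ₜ d))) := by
  rw [bracketAt, LinearMap.comp_apply, LinearMap.rTensor_tmul, TensorProduct.lift.tmul, substAt,
    TensorProduct.lift.tmul]
  generalize L.bracket a b = p
  induction p using Finsupp.induction_linear with
  | zero => simp
  | add p q hp hq =>
    rw [map_add, LinearMap.add_apply, hp, hq, Finsupp.sum_add_index']
    · simp
    · intro n x y; rw [TensorProduct.add_tmul, map_add, map_add]
  | single n v => simp

/-- `[[r, r]]` for `r` given as a sum of pure tensors. -/
theorem yangBaxter_sum (L : LeibnizConformalAlgebra k P) {ι : Type*} (s : Finset ι)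
    (a b : ι → P) :
    yangBaxter L (∑ i ∈ s, a i ⊗ₜ[k] b i) = ∑ i ∈ s, ∑ j ∈ s,
      (((L.bracket (a i) (a j)).sum fun n x => (del₂ k P ^ n) (x ⊗ₜ[k] b i ⊗ₜ[k] b j)) +
        ((L.bracket (b j) (b i)).sum fun n x => (del₂ k P ^ n) (a i ⊗ₜ[k] a j ⊗ₜ[k] x)) -
        ((L.bracket (b i) (a j)).sum fun n x => (del₁ k P ^ n) (a i ⊗ₜ[k] x ⊗ₜ[k] b j)) -
        ((L.bracket (a j) (b i)).sum fun n x =>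
          ((-del₁ k P - del₂ k P) ^ n) (a i ⊗ₜ[k] x ⊗ₜ[k] b j))) := by
  have h : (∑ i ∈ s, a i ⊗ₜ[k] b i) ⊗ₜ[k] (∑ i ∈ s, a i ⊗ₜ[k] b i) =
      ∑ i ∈ s, ∑ j ∈ s, (a i ⊗ₜ[k] b i) ⊗ₜ[k] (a j ⊗ₜ[k] b j) := by
    rw [TensorProduct.sum_tmul]
    simp only [TensorProduct.tmul_sum]
  rw [yangBaxter, h]
  simp only [map_sum, ← Finset.sum_sub_distrib, ← Finset.sum_add_distrib]
  refine Finset.sum_congr rfl fun i _ => Finset.sum_congr rfl fun j _ => ?_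
  simp only [swapMid, swapFst, slot₁, slot₂, slot₃, LinearEquiv.coe_coe, LinearMap.comp_apply,
    TensorProduct.tensorTensorTensorComm_tmul, TensorProduct.comm_tmul, LinearMap.rTensor_tmul,
    bracketAt_tmul, TensorProduct.assoc_symm_tmul]

/-- `r` is a solution of the CLCYBE: `[[r, r]] = 0` modulo the image of `∂_1 + ∂_2 + ∂_3`. -/
def IsCLCYBESolution (L : LeibnizConformalAlgebra k P) (r : P ⊗[k] P) : Prop :=
  yangBaxter L r ∈ LinearMap.range (del₁ k P + del₂ k P + del₃ k P)

/-- The flip `τ(a ⊗ b) = b ⊗ a`. -/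
def tau : P ⊗[k] P →ₗ[k] P ⊗[k] P := (TensorProduct.comm k P P).toLinearMap

/-- A symmetric solution of the CLCYBE. -/
def IsSymmetricSolution (L : LeibnizConformalAlgebra k P) (r : P ⊗[k] P) : Prop :=
  tau r = r ∧ IsCLCYBESolution L r

end YangBaxter

/-! ## `𝒪`-operators -/

section OOperator

variable {k : Type*} [Field k]
  {Q : Type*} [AddCommGroup Q] [Module k Q] [Module k[X] Q] [IsScalarTower k k[X] Q]
  {M : Type*} [AddCommGroup M] [Module k M] [Module k[X] M] [IsScalarTower k k[X] M]
  {L : LeibnizConformalAlgebra k Q}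

/-- A `k[∂]`-module homomorphism `T : M → Q` is an `𝒪`-operator associated to `(M, l, r)` if
`[T(x)_λ T(y)] = T(l(T(x))_λ y + r(T(y))_{-λ-∂} x)` in `Q[λ]`, with `T` applied to
coefficients on the right. -/
def IsOOperator (ρ : Representation L M) (T : M →ₗ[k[X]] Q) : Prop :=
  ∀ x y : M, L.bracket (T x) (T y) =
    Finsupp.mapRange.linearMap (T.restrictScalars k)
      (ρ.l (T x) y + skew k M (ρ.r (T y) x))

variable (k Q M) in
/-- The inclusion `M^{*c} ⊗ Q ⊆ (Q ⊕ M^{*c}) ⊗ (Q ⊕ M^{*c})`. -/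
def inclTensor : CDual k M ⊗[k] Q →ₗ[k] (Q × CDual k M) ⊗[k] (Q × CDual k M) :=
  TensorProduct.map (LinearMap.inr k Q (CDual k M)) (LinearMap.inl k Q (CDual k M))

end OOperator

end

end LeibnizConformal

namespace LeibnizConformal

noncomputable section

/-!
Call a functional on a `k[∂]`-module under which `∂` becomes a scalar `s` a character of weight
`s`; the values `⟨f, ·⟩_s` of conformal functionals are characters. On a free module `P` the image
of `∂_1 + ∂_2 + ∂_3` in `P ⊗ P ⊗ P` is cut out by the triples of such characters whose weights
sum to `0`, so `η(T) + τη(T)` solves the CLCYBE iff all these triples vanish on `[[r, r]]`.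

The characters of `P = Q ⊕ M^{*c}` of weight `u` are `⟨φ, ·⟩_u + ⟨·, x⟩_{-u}` with `φ ∈ Q^{*c}` and
`x ∈ M`. Contracting `r = η(T) + τη(T)` with such a character gives, as far as characters of the
relevant weights can tell, the pair `(T_0 x, ⟨φ, T_0 ·⟩)`. Hence the value of `[[r, r]]` at a triple
of characters is an alternating sum of four values of the defect of the `𝒪`-operator identity for
`T_0`, and taking `φ_1 = φ_2 = 0` and `x_3 = 0` isolates a single one.
-/

section Weights

variable {k : Type*} [Field k]
  {V W Z : Type*} [AddCommGroup V] [Module k V] [AddCommGroup W] [Module k W]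
  [AddCommGroup Z] [Module k Z]

/-- `ψ` is a weight vector of weight `s` for the transpose of `D`: under `ψ` the endomorphism `D`
becomes the scalar `s`. For `W = P` and `D = ∂` these `ψ` are the characters of `P`, the basic
examples being the values `⟨f, ·⟩_s` of conformal functionals. -/
def HasWeight (ψ : W →ₗ[k] Z) (D : Module.End k W) (s : k) : Prop :=
  ∀ w, ψ (D w) = s • ψ w

namespace HasWeight

variable {ψ : W →ₗ[k] Z} {D E : Module.End k W} {s t : k}

theorem add (hD : HasWeight ψ D s) (hE : HasWeight ψ E t) : HasWeight ψ (D + E) (s + t) :=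
  fun w => by rw [LinearMap.add_apply, map_add, hD, hE, add_smul]

theorem neg (hD : HasWeight ψ D s) : HasWeight ψ (-D) (-s) :=
  fun w => by rw [LinearMap.neg_apply, map_neg, hD, neg_smul]

theorem sub (hD : HasWeight ψ D s) (hE : HasWeight ψ E t) : HasWeight ψ (D - E) (s - t) := by
  simpa only [sub_eq_add_neg] using hD.add hE.neg

theorem map_subst (hD : HasWeight ψ D s) (φ : V →ₗ[k] W) (p : VPoly V) :
    ψ (subst D φ p) = ψ (φ (ev s p)) := by
  rw [LeibnizConformal.map_subst ψ D (s • 1) (fun w => by simp [hD w]), subst_scalar,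
    LinearMap.comp_apply]

theorem map_aeval (hD : HasWeight ψ D s) (p : k[X]) (w : W) :
    ψ (Polynomial.aeval D p w) = p.eval s • ψ w := by
  have hs : (s • 1 : Module.End k Z) = algebraMap k (Module.End k Z) s :=
    (Algebra.algebraMap_eq_smul_one s).symm
  rw [LeibnizConformal.map_aeval ψ D (s • 1) (fun w => by simp [hD w]), hs,
    Polynomial.aeval_algebraMap_apply_eq_algebraMap_eval, Module.algebraMap_end_apply]

end HasWeight

theorem hasWeight_pairAt [Module k[X] W] [IsScalarTower k k[X] W] (f : CDual k W) (u : k) :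
    HasWeight (pairAt f u) (del k W) u :=
  pairAt_del f u

theorem eq_of_forall_pairAt_eq [Infinite k] [Module k[X] W] [IsScalarTower k k[X] W]
    [Module.Free k[X] W] {v w : W}
    (h : ∀ (f : CDual k W) (u : k), pairAt f u v = pairAt f u w) : v = w :=
  let b := Module.Free.chooseBasis k[X] W
  b.ext_elem fun i => Polynomial.funext (h (dualBasis b i))

theorem eq_zero_of_forall_pairAt_ev_eq_zero [Infinite k] [Module k[X] W] [IsScalarTower k k[X] W]
    [Module.Free k[X] W] {p : VPoly W}
    (h : ∀ (f : CDual k W) (u s : k), pairAt f u (ev s p) = 0) : p = 0 :=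
  vpoly_ext (k := k) fun s => eq_of_forall_pairAt_eq (k := k) fun f u => by
    rw [h, map_zero, map_zero]

end Weights

section Detection

variable {k : Type*} [Field k]
  {P : Type*} [AddCommGroup P] [Module k P]

/-- The functional `χ₁ ⊗ χ₂ ⊗ χ₃` on `P ⊗ P ⊗ P`. -/
def triple (χ₁ χ₂ χ₃ : P →ₗ[k] k) : P ⊗[k] P ⊗[k] P →ₗ[k] k :=
  LinearMap.mul' k k ∘ₗ TensorProduct.map (LinearMap.mul' k k ∘ₗ TensorProduct.map χ₁ χ₂) χ₃

theorem triple_tmul (χ₁ χ₂ χ₃ : P →ₗ[k] k) (p q r : P) :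
    triple χ₁ χ₂ χ₃ (p ⊗ₜ q ⊗ₜ r) = χ₁ p * χ₂ q * χ₃ r := rfl

variable [Module k[X] P] [IsScalarTower k k[X] P]

theorem del₁_tmul (p q r : P) : del₁ k P (p ⊗ₜ q ⊗ₜ r) = del k P p ⊗ₜ q ⊗ₜ r := rfl

theorem del₂_tmul (p q r : P) : del₂ k P (p ⊗ₜ q ⊗ₜ r) = p ⊗ₜ del k P q ⊗ₜ r := rfl

theorem del₃_tmul (p q r : P) : del₃ k P (p ⊗ₜ q ⊗ₜ r) = p ⊗ₜ q ⊗ₜ del k P r := rfl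

variable (k P) in
/-- The total derivative `∂_1 + ∂_2 + ∂_3`, whose image is divided out in the CLCYBE. -/
abbrev totalDel : Module.End k (P ⊗[k] P ⊗[k] P) :=
  del₁ k P + del₂ k P + del₃ k P

namespace HasWeight

variable {χ₁ χ₂ χ₃ : P →ₗ[k] k} {s t u : k}

theorem triple₁ (h : HasWeight χ₁ (del k P) s) :
    HasWeight (triple χ₁ χ₂ χ₃) (del₁ k P) s :=
  LinearMap.congr_fun <| TensorProduct.ext_threefold
    (g := triple χ₁ χ₂ χ₃ ∘ₗ del₁ k P) (h := s • triple χ₁ χ₂ χ₃) fun p q r => by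
      simp only [LinearMap.comp_apply, LinearMap.smul_apply, del₁_tmul, triple_tmul, h p,
        smul_eq_mul]
      ring

theorem triple₂ (h : HasWeight χ₂ (del k P) t) :
    HasWeight (triple χ₁ χ₂ χ₃) (del₂ k P) t :=
  LinearMap.congr_fun <| TensorProduct.ext_threefold
    (g := triple χ₁ χ₂ χ₃ ∘ₗ del₂ k P) (h := t • triple χ₁ χ₂ χ₃) fun p q r => by
      simp only [LinearMap.comp_apply, LinearMap.smul_apply, del₂_tmul, triple_tmul, h q,
        smul_eq_mul]
      ring

theorem triple₃ (h : HasWeight χ₃ (del k P) u) :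
    HasWeight (triple χ₁ χ₂ χ₃) (del₃ k P) u :=
  LinearMap.congr_fun <| TensorProduct.ext_threefold
    (g := triple χ₁ χ₂ χ₃ ∘ₗ del₃ k P) (h := u • triple χ₁ χ₂ χ₃) fun p q r => by
      simp only [LinearMap.comp_apply, LinearMap.smul_apply, del₃_tmul, triple_tmul, h r,
        smul_eq_mul]
      ring

theorem triple_totalDel (h₁ : HasWeight χ₁ (del k P) s) (h₂ : HasWeight χ₂ (del k P) t)
    (h₃ : HasWeight χ₃ (del k P) u) :
    HasWeight (triple χ₁ χ₂ χ₃) (totalDel k P) (s + t + u) :=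
  (h₁.triple₁.add h₂.triple₂).add h₃.triple₃

end HasWeight

theorem commute_del₁_del₂ : Commute (del₁ k P) (del₂ k P) :=
  TensorProduct.ext_threefold fun p q r => by
    simp only [Module.End.mul_apply, del₁_tmul, del₂_tmul]

theorem commute_del₁_del₃ : Commute (del₁ k P) (del₃ k P) :=
  TensorProduct.ext_threefold fun p q r => by
    simp only [Module.End.mul_apply, del₁_tmul, del₃_tmul]

theorem commute_del₂_del₃ : Commute (del₂ k P) (del₃ k P) :=
  TensorProduct.ext_threefold fun p q r => by
    simp only [Module.End.mul_apply, del₂_tmul, del₃_tmul]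

/-- `∑ λ ^ n r_n ↦ ∑ ∂ ^ n a ⊗ b ⊗ r_n`. -/
def ofVPoly (a b : P) : VPoly P →ₗ[k] P ⊗[k] P ⊗[k] P :=
  subst (del₁ k P) (TensorProduct.mk k (P ⊗[k] P) P (a ⊗ₜ b))

theorem ofVPoly_const (a b r : P) : ofVPoly (k := k) a b (const k P r) = a ⊗ₜ b ⊗ₜ r := by
  simp [ofVPoly, const, subst_single]

theorem ofVPoly_lam (a b : P) (p : VPoly P) :
    ofVPoly a b (lam k P p) = del₁ k P (ofVPoly a b p) :=
  subst_lam _ _ p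

theorem ofVPoly_del (a b : P) (p : VPoly P) :
    ofVPoly a b (del k (VPoly P) p) = del₃ k P (ofVPoly a b p) := by
  rw [ofVPoly, map_subst (del₃ k P) (del₁ k P) (del₁ k P)
    (fun w => (LinearMap.congr_fun commute_del₁_del₃.eq w).symm), del_eq_mapRange]
  induction p using Finsupp.induction_linear with
  | zero => simp only [map_zero]
  | add p q hp hq => simp only [map_add, hp, hq]
  | single n v => simp [subst_single, del₃_tmul]

theorem triple_ofVPoly {χ₁ : P →ₗ[k] k} {s : k} (h : HasWeight χ₁ (del k P) s)
    (χ₂ χ₃ : P →ₗ[k] k) (a b : P) (p : VPoly P) :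
    triple χ₁ χ₂ χ₃ (ofVPoly a b p) = χ₁ a * χ₂ b * χ₃ (ev s p) := by
  rw [ofVPoly, h.triple₁.map_subst, TensorProduct.mk_apply, triple_tmul]

/-- `(p_{ij}) ↦ ∑ p_{ij}(∂_1)(e_i ⊗ e_j ⊗ ·)`. For a basis `e` of `P` over `k[∂]` its image is a
complement of the image of `∂_1 + ∂_2 + ∂_3`. -/
def assemble {ι : Type*} (e : ι → P) : (ι × ι →₀ VPoly P) →ₗ[k] P ⊗[k] P ⊗[k] P :=
  Finsupp.lsum k fun ij => ofVPoly (e ij.1) (e ij.2)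

theorem assemble_single {ι : Type*} (e : ι → P) (i j : ι) (p : VPoly P) :
    assemble e (Finsupp.single (i, j) p) = ofVPoly (k := k) (e i) (e j) p :=
  Finsupp.lsum_single k _ _ _

theorem triple_assemble {ι : Type*} (b : Module.Basis ι k[X] P) (i j : ι) (s t : k)
    (χ : P →ₗ[k] k) (p : ι × ι →₀ VPoly P) :
    triple (pairAt (dualBasis b i) s) (pairAt (dualBasis b j) t) χ (assemble b p) =
      χ (ev s (p (i, j))) := by
  classical
  induction p using Finsupp.induction_linear with
  | zero => simp only [map_zero, Finsupp.zero_apply]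
  | add p q hp hq => simp only [map_add, Finsupp.add_apply, hp, hq]
  | single ij p =>
    obtain ⟨m, n⟩ := ij
    rw [assemble_single, triple_ofVPoly (hasWeight_pairAt _ s), pairAt_apply, pairAt_apply,
      pair_dualBasis, pair_dualBasis, Finsupp.single_apply]
    rcases eq_or_ne i m with rfl | hi <;> rcases eq_or_ne j n with rfl | hj <;> simp [*, Ne.symm]

theorem range_assemble_mem_invtSubmodule {ι : Type*} (e : ι → P)
    {D : Module.End k (P ⊗[k] P ⊗[k] P)} (D' : Module.End k (VPoly P))
    (h : ∀ a b p, ofVPoly a b (D' p) = D (ofVPoly a b p)) :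
    LinearMap.range (assemble e) ∈ D.invtSubmodule := by
  rintro _ ⟨p, rfl⟩
  change D (assemble e p) ∈ LinearMap.range (assemble e)
  induction p using Finsupp.induction_linear with
  | zero => simp only [map_zero, Submodule.zero_mem]
  | add p q hp hq => simpa only [map_add] using add_mem hp hq
  | single ij p =>
    exact ⟨Finsupp.single ij (D' p), by rw [assemble_single, assemble_single, h]⟩

theorem range_mem_invtSubmodule_of_commute {W : Type*} [AddCommGroup W] [Module k W]
    {D E : Module.End k W} (h : Commute D E) : LinearMap.range D ∈ E.invtSubmodule := by
  rintro _ ⟨w, rfl⟩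
  exact ⟨E w, LinearMap.congr_fun h.eq w⟩

theorem mem_of_forall_basis_mem {ι : Type*} (b : Module.Basis ι k[X] P) {N : Submodule k P}
    (hN : N ∈ (del k P).invtSubmodule) (hb : ∀ i, b i ∈ N) (v : P) : v ∈ N := by
  induction b.mem_span v using Submodule.span_induction with
  | mem x hx =>
    obtain ⟨i, rfl⟩ := hx
    exact hb i
  | zero => exact N.zero_mem
  | add x y _ _ hx hy => exact N.add_mem hx hy
  | smul p x _ hx =>
    have h := map_aeval N.subtype ((del k P).restrict hN) (del k P) (fun _ => rfl) p ⟨x, hx⟩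
    rw [Submodule.subtype_apply, Submodule.subtype_apply, aeval_del] at h
    exact h ▸ Subtype.property _

theorem eq_top_of_basis_tmul_mem {ι : Type*} (b : Module.Basis ι k[X] P)
    {N : Submodule k (P ⊗[k] P ⊗[k] P)} (h₁ : N ∈ (del₁ k P).invtSubmodule)
    (h₂ : N ∈ (del₂ k P).invtSubmodule) (hb : ∀ i j r, b i ⊗ₜ b j ⊗ₜ r ∈ N) : N = ⊤ := by
  have hbq : ∀ i q r, b i ⊗ₜ q ⊗ₜ r ∈ N := fun i q r =>
    mem_of_forall_basis_mem b (N := N.comap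
      ((TensorProduct.mk k (P ⊗[k] P) P).flip r ∘ₗ TensorProduct.mk k P P (b i)))
      (fun x hx => h₂ hx) (fun j => hb i j r) q
  have hpq : ∀ p q r, p ⊗ₜ q ⊗ₜ r ∈ N := fun p q r =>
    mem_of_forall_basis_mem b (N := N.comap
      ((TensorProduct.mk k (P ⊗[k] P) P).flip r ∘ₗ (TensorProduct.mk k P P).flip q))
      (fun x hx => h₁ hx) (fun i => hbq i q r) p
  refine (Submodule.eq_top_iff').mpr fun w => ?_
  induction w using TensorProduct.induction_on with
  | zero => exact N.zero_mem
  | add x y hx hy => exact N.add_mem hx hy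
  | tmul x r =>
    induction x using TensorProduct.induction_on with
    | zero => simp only [TensorProduct.zero_tmul, N.zero_mem]
    | add x y hx hy => simpa only [TensorProduct.add_tmul] using N.add_mem hx hy
    | tmul p q => exact hpq p q r

theorem range_totalDel_sup_range_assemble {ι : Type*} (b : Module.Basis ι k[X] P) :
    LinearMap.range (totalDel k P) ⊔ LinearMap.range (assemble b) = ⊤ := by
  set N := LinearMap.range (totalDel k P) ⊔ LinearMap.range (assemble (k := k) b)
  have h₁ : N ∈ (del₁ k P).invtSubmodule :=
    Sublattice.sup_mem
      (range_mem_invtSubmodule_of_commute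
        (((Commute.refl _).add_left commute_del₁_del₂.symm).add_left commute_del₁_del₃.symm))
      (range_assemble_mem_invtSubmodule b (lam k P) ofVPoly_lam)
  have h₃ : N ∈ (del₃ k P).invtSubmodule :=
    Sublattice.sup_mem
      (range_mem_invtSubmodule_of_commute
        ((commute_del₁_del₃.add_left commute_del₂_del₃).add_left (Commute.refl _)))
      (range_assemble_mem_invtSubmodule b (del k (VPoly P)) ofVPoly_del)
  have h₂ : N ∈ (del₂ k P).invtSubmodule := fun w hw => by
    have hD : totalDel k P w ∈ N := Submodule.mem_sup_left ⟨w, rfl⟩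
    have hdel₂ : del₂ k P w = totalDel k P w - del₁ k P w - del₃ k P w := by
      simp only [LinearMap.add_apply]
      abel
    rw [Submodule.mem_comap, hdel₂]
    exact N.sub_mem (N.sub_mem hD (h₁ hw)) (h₃ hw)
  exact eq_top_of_basis_tmul_mem b h₁ h₂ fun i j r => Submodule.mem_sup_right
    ⟨Finsupp.single (i, j) (const k P r), by rw [assemble_single, ofVPoly_const]⟩

/-- The total derivative acts by `s + t + u` under a triple of characters, which gives one
direction; for the other, modulo its image every tensor is of the form `∑ p_{ij}(∂_1)(e_i ⊗ e_j)`,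
and triples of dual basis characters recover the values of the coefficients `p_{ij}`. -/
theorem mem_range_totalDel_iff [Infinite k] [Module.Free k[X] P] {w : P ⊗[k] P ⊗[k] P} :
    w ∈ LinearMap.range (totalDel k P) ↔ ∀ (f g h : CDual k P) (s t u : k), s + t + u = 0 →
      triple (pairAt f s) (pairAt g t) (pairAt h u) w = 0 := by
  have vanish : ∀ (f g h : CDual k P) (s t u : k), s + t + u = 0 → ∀ z,
      triple (pairAt f s) (pairAt g t) (pairAt h u) (totalDel k P z) = 0 :=
    fun f g h s t u hstu z => by
      rw [HasWeight.triple_totalDel (hasWeight_pairAt f s) (hasWeight_pairAt g t)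
        (hasWeight_pairAt h u) z, hstu, zero_smul]
  refine ⟨?_, fun hw => ?_⟩
  · rintro ⟨z, rfl⟩ f g h s t u hstu
    exact vanish f g h s t u hstu z
  let b := Module.Free.chooseBasis k[X] P
  obtain ⟨_, ⟨z, rfl⟩, _, ⟨p, rfl⟩, rfl⟩ :=
    Submodule.mem_sup.mp ((range_totalDel_sup_range_assemble b).ge (Submodule.mem_top (x := w)))
  have hp : p = 0 := by
    ext1 ⟨i, j⟩
    refine eq_zero_of_forall_pairAt_ev_eq_zero (k := k) fun h u s => ?_
    have hstu : s + (-s - u) + u = 0 := by ring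
    have hzp := hw (dualBasis b i) (dualBasis b j) h s (-s - u) u hstu
    rwa [map_add, vanish _ _ _ _ _ _ hstu, zero_add, triple_assemble] at hzp
  exact ⟨z, by rw [hp, map_zero, add_zero]⟩

end Detection

section YangBaxterValues

variable {k : Type*} [Field k] {P : Type*} [AddCommGroup P] [Module k P]

/-- `a ⊗ b ↦ χ(a) b`, the contraction of the first factor by `χ`. -/
def contractLeft (χ : P →ₗ[k] k) : P ⊗[k] P →ₗ[k] P :=
  (TensorProduct.lid k P).toLinearMap ∘ₗ LinearMap.rTensor P χ

theorem contractLeft_tmul (χ : P →ₗ[k] k) (a b : P) : contractLeft χ (a ⊗ₜ b) = χ a • b := rfl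

theorem tau_tmul (a b : P) : tau (a ⊗ₜ[k] b) = b ⊗ₜ a := rfl

theorem apply_tmul_eq_of_pure (Φ : (P ⊗[k] P) ⊗[k] (P ⊗[k] P) →ₗ[k] k) (β : P →ₗ[k] P →ₗ[k] k)
    (A B : P ⊗[k] P →ₗ[k] P)
    (h : ∀ a b c d, Φ ((a ⊗ₜ b) ⊗ₜ (c ⊗ₜ d)) = β (A (a ⊗ₜ b)) (B (c ⊗ₜ d)))
    (r r' : P ⊗[k] P) : Φ (r ⊗ₜ r') = β (A r) (B r') := by
  suffices H : Φ = TensorProduct.lift (β.compl₁₂ A B) by rw [H]; rfl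
  exact TensorProduct.ext_fourfold' h

theorem triple_slot₁ (χ₁ χ₂ χ₃ : P →ₗ[k] k) (x y z : P) :
    triple χ₁ χ₂ χ₃ (slot₁ k P (x ⊗ₜ (y ⊗ₜ z))) = χ₁ x * χ₂ y * χ₃ z := rfl

theorem triple_slot₂ (χ₁ χ₂ χ₃ : P →ₗ[k] k) (x y z : P) :
    triple χ₁ χ₂ χ₃ (slot₂ k P (x ⊗ₜ (y ⊗ₜ z))) = χ₁ y * χ₂ x * χ₃ z := rfl

theorem triple_slot₃ (χ₁ χ₂ χ₃ : P →ₗ[k] k) (x y z : P) :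
    triple χ₁ χ₂ χ₃ (slot₃ k P (x ⊗ₜ (y ⊗ₜ z))) = χ₁ y * χ₂ z * χ₃ x := rfl

variable [Module k[X] P] [IsScalarTower k k[X] P] (L : LeibnizConformalAlgebra k P)

theorem HasWeight.map_bracketAt {ψ : P ⊗[k] P ⊗[k] P →ₗ[k] k}
    {D : Module.End k (P ⊗[k] P ⊗[k] P)} {s : k} (hD : HasWeight ψ D s)
    (ω : P ⊗[k] (P ⊗[k] P) →ₗ[k] P ⊗[k] P ⊗[k] P) (a b c d : P) :
    ψ (bracketAt L D ω ((a ⊗ₜ b) ⊗ₜ (c ⊗ₜ d))) =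
      ψ (ω (ev s (L.bracket a b) ⊗ₜ (c ⊗ₜ d))) :=
  (congrArg ψ (bracketAt_tmul L D ω a b c d)).trans
    (hD.map_subst (ω ∘ₗ (TensorProduct.mk k P (P ⊗[k] P)).flip (c ⊗ₜ d)) (L.bracket a b))

variable {χ₁ χ₂ : P →ₗ[k] k} {s t : k}

theorem triple_yangBaxter (h₁ : HasWeight χ₁ (del k P) s) (h₂ : HasWeight χ₂ (del k P) t)
    (χ₃ : P →ₗ[k] k) (r : P ⊗[k] P) :
    triple χ₁ χ₂ χ₃ (yangBaxter L r) =
      χ₁ (ev t (L.bracket (contractLeft χ₂ (tau r)) (contractLeft χ₃ (tau r)))) +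
        χ₃ (ev t (L.bracket (contractLeft χ₂ r) (contractLeft χ₁ r))) -
        χ₂ (ev s (L.bracket (contractLeft χ₁ r) (contractLeft χ₃ (tau r)))) -
        χ₂ (ev (-s - t) (L.bracket (contractLeft χ₃ (tau r)) (contractLeft χ₁ r))) := by
  rw [yangBaxter, map_sub, map_sub, map_add]
  refine congrArg₂ (· - ·) (congrArg₂ (· - ·) (congrArg₂ (· + ·) ?_ ?_) ?_) ?_
  · refine apply_tmul_eq_of_pure (triple χ₁ χ₂ χ₃ ∘ₗ bracketAt L (del₂ k P) (slot₁ k P) ∘ₗ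
      swapMid k P) (L.bracket.compr₂ (χ₁ ∘ₗ ev t)) (contractLeft χ₂ ∘ₗ tau)
      (contractLeft χ₃ ∘ₗ tau) (fun a b c d => ?_) r r
    refine (h₂.triple₂.map_bracketAt L (slot₁ k P) a c b d).trans ?_
    simp only [triple_slot₁, LinearMap.comp_apply, LinearMap.compr₂_apply,
      contractLeft_tmul, tau_tmul, map_smul, LinearMap.smul_apply, smul_eq_mul]
    ring
  · refine apply_tmul_eq_of_pure (triple χ₁ χ₂ χ₃ ∘ₗ bracketAt L (del₂ k P) (slot₃ k P) ∘ₗ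
      swapFst k P ∘ₗ (TensorProduct.comm k _ _).toLinearMap ∘ₗ swapMid k P)
      (L.bracket.compr₂ (χ₃ ∘ₗ ev t)).flip (contractLeft χ₁) (contractLeft χ₂)
      (fun a b c d => ?_) r r
    refine (h₂.triple₂.map_bracketAt L (slot₃ k P) d b a c).trans ?_
    simp only [triple_slot₃, LinearMap.comp_apply, LinearMap.flip_apply, LinearMap.compr₂_apply,
      contractLeft_tmul, map_smul, LinearMap.smul_apply, smul_eq_mul]
    ring
  · refine apply_tmul_eq_of_pure (triple χ₁ χ₂ χ₃ ∘ₗ bracketAt L (del₁ k P) (slot₂ k P) ∘ₗ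
      swapMid k P ∘ₗ swapFst k P) (L.bracket.compr₂ (χ₂ ∘ₗ ev s)) (contractLeft χ₁)
      (contractLeft χ₃ ∘ₗ tau) (fun a b c d => ?_) r r
    refine (h₁.triple₁.map_bracketAt L (slot₂ k P) b c a d).trans ?_
    simp only [triple_slot₂, LinearMap.comp_apply, LinearMap.compr₂_apply,
      contractLeft_tmul, tau_tmul, map_smul, LinearMap.smul_apply, smul_eq_mul]
    ring
  · refine apply_tmul_eq_of_pure (triple χ₁ χ₂ χ₃ ∘ₗ bracketAt L (-del₁ k P - del₂ k P)
      (slot₂ k P) ∘ₗ swapFst k P ∘ₗ swapMid k P ∘ₗ swapFst k P)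
      (L.bracket.compr₂ (χ₂ ∘ₗ ev (-s - t))).flip (contractLeft χ₁) (contractLeft χ₃ ∘ₗ tau)
      (fun a b c d => ?_) r r
    refine ((h₁.triple₁.neg.sub h₂.triple₂).map_bracketAt L (slot₂ k P) c b a d).trans ?_
    simp only [triple_slot₂, LinearMap.comp_apply, LinearMap.flip_apply, LinearMap.compr₂_apply,
      contractLeft_tmul, tau_tmul, map_smul, LinearMap.smul_apply, smul_eq_mul]
    ring

end YangBaxterValues

section Duality

variable {k : Type*} [Field k]
  {Q : Type*} [AddCommGroup Q] [Module k Q] [Module k[X] Q] [IsScalarTower k k[X] Q]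
  {M : Type*} [AddCommGroup M] [Module k M] [Module k[X] M] [IsScalarTower k k[X] M]

theorem pair_smul (f : CDual k M) (p : k[X]) (v : M) : pair f (p • v) = p * pair f v := by
  rw [← aeval_del, map_aeval (pair f) _ (del k k[X]) (pair_del f), aeval_del, smul_eq_mul]

theorem pair_smul_left (p : k[X]) (f : CDual k M) (v : M) :
    pair (p • f) v = p.comp (-Polynomial.X) * pair f v := by
  have hdel : ∀ g : CDual k M, pair.flip v (del k (CDual k M) g) =
      Algebra.lmul k k[X] (-Polynomial.X) (pair.flip v g) := fun g => by
    simp [pair_del_left]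
  rw [← aeval_del, ← LinearMap.flip_apply, map_aeval (pair.flip v) _ _ hdel,
    Polynomial.aeval_algHom_apply, Polynomial.comp_eq_aeval]
  rfl

theorem sum_pair_smul_dualBasis {ι : Type*} [Fintype ι] (b : Module.Basis ι k[X] M)
    (f : CDual k M) : ∑ i, (pair f (b i)).comp (-Polynomial.X) • dualBasis b i = f := by
  refine CDual.ext fun v => ?_
  calc pair (∑ i, (pair f (b i)).comp (-Polynomial.X) • dualBasis b i) v
      = ∑ i, pair f (b i) * b.repr v i := by
        simp only [map_sum, LinearMap.sum_apply, pair_smul_left,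
          Polynomial.comp_neg_X_comp_neg_X]
        rfl
    _ = pair f (∑ i, b.repr v i • b i) := by simp only [map_sum, pair_smul, mul_comm]
    _ = pair f v := by rw [b.sum_repr]

theorem linearIndependent_dualBasis {ι : Type*} [Finite ι] (b : Module.Basis ι k[X] M) :
    LinearIndependent k[X] (dualBasis b) := by
  classical
  cases nonempty_fintype ι
  refine Fintype.linearIndependent_iff.mpr fun g hg j => ?_
  have hgj : (g j).comp (-Polynomial.X) = 0 := by
    simpa [pair_smul_left, pair_dualBasis] using congrArg (fun f => pair f (b j)) hg
  rw [← Polynomial.comp_neg_X_comp_neg_X (g j), hgj, Polynomial.zero_comp]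

instance CDual.free [Module.Finite k[X] M] [Module.Free k[X] M] :
    Module.Free k[X] (CDual k M) :=
  let b := Module.Free.chooseBasis k[X] M
  Module.Free.of_basis <| Module.Basis.mk (linearIndependent_dualBasis b) fun f _ =>
    sum_pair_smul_dualBasis b f ▸ Submodule.sum_mem _ fun i _ =>
      Submodule.smul_mem _ _ (Submodule.subset_span ⟨i, rfl⟩)

/-- A finite free module is reflexive for the conformal dual; the sign comes from `∂` acting on
`M^{*c}` by `-λ`. -/
theorem exists_pair_eq_pair_comp_neg_X [Module.Finite k[X] M] [Module.Free k[X] M]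
    (F : CDual k (CDual k M)) : ∃ x : M, ∀ f, pair F f = (pair f x).comp (-Polynomial.X) := by
  let b := Module.Free.chooseBasis k[X] M
  refine ⟨∑ i, (pair F (dualBasis b i)).comp (-Polynomial.X) • b i, fun f => ?_⟩
  conv_lhs => rw [← sum_pair_smul_dualBasis b f]
  simp only [map_sum, pair_smul, Polynomial.sum_comp, Polynomial.mul_comp,
    Polynomial.comp_neg_X_comp_neg_X, mul_comm]

/-- The conformal functional `(q, f) ↦ ⟨φ, q⟩_λ + ⟨f, x⟩_{-λ}` on `Q ⊕ M^{*c}`. -/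
def prodChar (φ : CDual k Q) (x : M) : CDual k (Q × CDual k M) :=
  CDual.mk (pair φ ∘ₗ LinearMap.fst k Q (CDual k M) +
    (Polynomial.aeval (-Polynomial.X : k[X])).toLinearMap ∘ₗ pair.flip x ∘ₗ
      LinearMap.snd k Q (CDual k M)) fun p => by
    simp [del_prod, pair_del, pair_del_left, mul_add]

theorem pair_prodChar (φ : CDual k Q) (x : M) (p : Q × CDual k M) :
    pair (prodChar φ x) p = pair φ p.1 + (pair p.2 x).comp (-Polynomial.X) := rfl

theorem pairAt_prodChar (φ : CDual k Q) (x : M) (u : k) (p : Q × CDual k M) :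
    pairAt (prodChar φ x) u p = pairAt φ u p.1 + pairAt p.2 (-u) x := by
  simp [pairAt_apply, pair_prodChar]

theorem exists_eq_prodChar [Module.Finite k[X] M] [Module.Free k[X] M]
    (F : CDual k (Q × CDual k M)) : ∃ φ x, F = prodChar φ x := by
  let φ : CDual k Q := CDual.mk (pair F ∘ₗ LinearMap.inl k Q (CDual k M)) fun q => by
    simp [← pair_del, del_prod]
  let F₂ : CDual k (CDual k M) := CDual.mk (pair F ∘ₗ LinearMap.inr k Q (CDual k M)) fun f => by
    simp [← pair_del, del_prod]
  obtain ⟨x, hx⟩ := exists_pair_eq_pair_comp_neg_X F₂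
  refine ⟨φ, x, CDual.ext fun p => ?_⟩
  calc pair F p = pair F (p.1, 0) + pair F (0, p.2) := by rw [← map_add, Prod.fst_add_snd]
    _ = pair (prodChar φ x) p := by rw [pair_prodChar, ← hx]; rfl

end Duality

section SymmetricTensor

variable {k : Type*} [Field k]
  {Q : Type*} [AddCommGroup Q] [Module k Q]
  {M : Type*} [AddCommGroup M] [Module k M] [Module k[X] M] [IsScalarTower k k[X] M]

/-- `e + τ e` for `e ∈ M^{*c} ⊗ Q`. -/
def symTensor : CDual k M ⊗[k] Q →ₗ[k] (Q × CDual k M) ⊗[k] (Q × CDual k M) :=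
  inclTensor k Q M + tau ∘ₗ inclTensor k Q M

theorem tau_symTensor (e : CDual k M ⊗[k] Q) : tau (symTensor e) = symTensor e := by
  have tau_tau : ∀ w : (Q × CDual k M) ⊗[k] (Q × CDual k M), tau (tau w) = w :=
    (TensorProduct.comm k _ _).symm_apply_apply
  simp [symTensor, tau_tau, add_comm]

theorem contractLeft_symTensor_tmul (χ : (Q × CDual k M) →ₗ[k] k) (f : CDual k M) (a : Q) :
    contractLeft χ (symTensor (f ⊗ₜ a)) = (χ (0, f) • a, χ (a, 0) • f) :=
  calc contractLeft χ (symTensor (f ⊗ₜ a))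
      = χ (0, f) • (a, (0 : CDual k M)) + χ (a, 0) • ((0 : Q), f) := by
        rw [symTensor, LinearMap.add_apply, map_add]; rfl
    _ = (χ (0, f) • a, χ (a, 0) • f) := by simp

variable [Module k[X] Q] [IsScalarTower k k[X] Q]

variable {Z : Type*} [AddCommGroup Z] [Module k Z] {ψ : Q →ₗ[k] Z}

theorem HasWeight.atZero_phi_tmul {c : k} (hψ : HasWeight ψ (del k Q) c) (f : CDual k M) (a : Q)
    (x : M) : ψ ((phi k M Q (f ⊗ₜ a)).atZero x) = pairAt f c x • ψ a := by
  have hweight : HasWeight (ψ ∘ₗ Finsupp.lapply 0) (lam k Q + del k (VPoly Q)) c := fun p => by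
    simp [lam_zero, del_coeff, hψ _]
  refine (hweight.map_aeval (pair f x) (const k Q a)).trans ?_
  simp [const, pairAt_apply]

theorem HasWeight.contractLeft_symTensor_fst {u : k} (hψ : HasWeight ψ (del k Q) (-u))
    (φ : CDual k Q) (x : M) (e : CDual k M ⊗[k] Q) :
    ψ (contractLeft (pairAt (prodChar φ x) u) (symTensor e)).1 =
      ψ ((phi k M Q e).atZero x) := by
  induction e using TensorProduct.induction_on with
  | zero => simp [show (0 : Chom k M Q).atZero x = 0 from rfl]
  | add e e' he he' =>
    simp only [map_add, Prod.fst_add, he, he']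
    exact (map_add ψ _ _).symm
  | tmul f a =>
    rw [hψ.atZero_phi_tmul, contractLeft_symTensor_tmul, pairAt_prodChar]
    simp

theorem contractLeft_symTensor_snd (φ : CDual k Q) (x v : M) (u : k) (e : CDual k M ⊗[k] Q) :
    pairAt (contractLeft (pairAt (prodChar φ x) u) (symTensor e)).2 u v =
      pairAt φ u ((phi k M Q e).atZero v) := by
  induction e using TensorProduct.induction_on with
  | zero => simp [show (0 : Chom k M Q).atZero v = 0 from rfl, pairAt_apply]
  | add e e' he he' =>
    simp only [map_add, Prod.snd_add, pairAt_add, he, he']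
    exact (map_add (pairAt φ u) _ _).symm
  | tmul f a =>
    have hφ : pairAt (prodChar φ x) u ((a, 0) : Q × CDual k M) = pairAt φ u a := by
      rw [pairAt_prodChar]
      simp [pairAt_apply]
    rw [(hasWeight_pairAt φ u).atZero_phi_tmul, contractLeft_symTensor_tmul, hφ]
    simp [pairAt_apply, mul_comm]

end SymmetricTensor

section Defect

variable {k : Type*} [Field k]
  {Q : Type*} [AddCommGroup Q] [Module k Q] [Module k[X] Q] [IsScalarTower k k[X] Q]
  {M : Type*} [AddCommGroup M] [Module k M] [Module k[X] M] [IsScalarTower k k[X] M]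
  {L : LeibnizConformalAlgebra k Q}

/-- The defect `[S(x)_λ S(y)] - S(l(S(x))_λ y + r(S(y))_{-λ-∂} x)` of the `𝒪`-operator identity. -/
def defect (ρ : Representation L M) (S : M →ₗ[k[X]] Q) (x y : M) : VPoly Q :=
  L.bracket (S x) (S y) - Finsupp.mapRange.linearMap (S.restrictScalars k)
    (ρ.l (S x) y + skew k M (ρ.r (S y) x))

theorem isOOperator_iff_defect_eq_zero (ρ : Representation L M) (S : M →ₗ[k[X]] Q) :
    IsOOperator ρ S ↔ ∀ x y, defect ρ S x y = 0 :=
  forall₂_congr fun _ _ => sub_eq_zero.symm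

theorem pairAt_ev_defect (ρ : Representation L M) (S : M →ₗ[k[X]] Q) (x y : M) (φ : CDual k Q)
    (u s : k) :
    pairAt φ u (ev s (defect ρ S x y)) =
      pairAt φ u (ev s (L.bracket (S x) (S y))) - pairAt φ u (S (ev s (ρ.l (S x) y))) -
        pairAt φ u (S (ev (-s - u) (ρ.r (S y) x))) := by
  have hskew : pairAt φ u (S (evS s (ρ.r (S y) x))) = pairAt φ u (S (ev (-s - u) (ρ.r (S y) x))) :=
    map_evS (pairAt φ u ∘ₗ S.restrictScalars k) u s
      (fun v => (congrArg (pairAt φ u) (map_smul S _ v)).trans (pairAt_del φ u (S v))) _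
  rw [defect, map_sub, map_sub, ev_mapRange, map_add, ev_skew, LinearMap.restrictScalars_apply,
    map_add, map_add, hskew, sub_sub]

theorem ev_map_contractLeft_symTensor (l : Q →ₗ[k[X]] Chom k M M) (φ : CDual k Q) (x v : M)
    (s : k) (e : CDual k M ⊗[k] Q) :
    ev s (l (contractLeft (pairAt (prodChar φ x) s) (symTensor e)).1 v) =
      ev s (l ((phi k M Q e).atZero x) v) :=
  HasWeight.contractLeft_symTensor_fst (ψ := ev s ∘ₗ Chom.toLin.flip v ∘ₗ l.restrictScalars k)
    (fun q => by simp [lin_map_del, Chom.del_apply, ev_lam]) φ x e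

theorem ev_bracket_contractLeft_symTensor_left (L : LeibnizConformalAlgebra k Q) (φ : CDual k Q)
    (x : M) (q : Q) (s : k) (e : CDual k M ⊗[k] Q) :
    ev s (L.bracket (contractLeft (pairAt (prodChar φ x) s) (symTensor e)).1 q) =
      ev s (L.bracket ((phi k M Q e).atZero x) q) :=
  HasWeight.contractLeft_symTensor_fst (ψ := ev s ∘ₗ L.bracket.flip q)
    (fun p => by simp [L.del_left, ev_lam]) φ x e

theorem pairAt_ev_bracket_contractLeft_symTensor_right (L : LeibnizConformalAlgebra k Q)
    (φ φ' : CDual k Q) (x : M) (q : Q) (e : CDual k M ⊗[k] Q) {s t u : k} (hstu : s + t + u = 0) :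
    pairAt φ u (ev s (L.bracket q (contractLeft (pairAt (prodChar φ' x) t) (symTensor e)).1)) =
      pairAt φ u (ev s (L.bracket q ((phi k M Q e).atZero x))) :=
  HasWeight.contractLeft_symTensor_fst (ψ := pairAt φ u ∘ₗ ev s ∘ₗ L.bracket q)
    (fun p => by
      rw [show -t = s + u by linear_combination -hstu]
      simp [L.del_right, ev_lam, ev_del, pairAt_del, add_mul]) φ' x e

variable [CharZero k] [Module.Finite k[X] M]

theorem pairAt_prodChar_ev_dual_semidirect_bracket (ρ : Representation L M) (φ : CDual k Q) (x : M)
    (R₁ R₂ : Q × CDual k M) {s t u : k} (hstu : s + t + u = 0) :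
    pairAt (prodChar φ x) u (ev s (ρ.dual.semidirect.bracket R₁ R₂)) =
      pairAt φ u (ev s (L.bracket R₁.1 R₂.1)) - pairAt R₂.2 t (ev s (ρ.l R₁.1 x)) +
        pairAt R₁.2 s (ev t (ρ.l R₂.1 x)) + pairAt R₁.2 s (ev t (ρ.r R₂.1 x)) := by
  have hbracket : ev s (ρ.dual.semidirect.bracket R₁ R₂) = (ev s (L.bracket R₁.1 R₂.1),
      ev s (dualCend k M (ρ.l R₁.1) R₂.2) + evS s (ρ.dualRight R₂.1 R₁.2)) :=
    ρ.dual.ev_semidirectBracket s R₁ R₂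
  rw [hbracket, pairAt_prodChar, pairAt_add, pairAt_dual, pairAt_evS, ρ.pairAt_dualRight,
    show -u - s = t by linear_combination -hstu, show -u - t = s by linear_combination -hstu]
  ring

theorem pairAt_prodChar_ev_bracket_contractLeft_symTensor (ρ : Representation L M)
    (φ φ₁ φ₂ : CDual k Q) (x x₁ x₂ : M) (e : CDual k M ⊗[k] Q) {s t u : k} (hstu : s + t + u = 0) :
    pairAt (prodChar φ x) u (ev s (ρ.dual.semidirect.bracket
        (contractLeft (pairAt (prodChar φ₁ x₁) s) (symTensor e))
        (contractLeft (pairAt (prodChar φ₂ x₂) t) (symTensor e)))) =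
      pairAt φ u (ev s (L.bracket ((phi k M Q e).atZero x₁) ((phi k M Q e).atZero x₂))) -
        pairAt φ₂ t ((phi k M Q e).atZero (ev s (ρ.l ((phi k M Q e).atZero x₁) x))) +
        pairAt φ₁ s ((phi k M Q e).atZero (ev t (ρ.l ((phi k M Q e).atZero x₂) x))) +
        pairAt φ₁ s ((phi k M Q e).atZero (ev t (ρ.r ((phi k M Q e).atZero x₂) x))) := by
  rw [pairAt_prodChar_ev_dual_semidirect_bracket ρ φ x _ _ hstu,
    ev_bracket_contractLeft_symTensor_left,
    pairAt_ev_bracket_contractLeft_symTensor_right _ _ _ _ _ _ hstu]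
  simp only [contractLeft_symTensor_snd, ev_map_contractLeft_symTensor]

/-- The four brackets also produce four terms in `l` that belong to no defect; these cancel in
pairs. -/
theorem triple_yangBaxter_symTensor (ρ : Representation L M) (e : CDual k M ⊗[k] Q)
    (φ₁ φ₂ φ₃ : CDual k Q) (x₁ x₂ x₃ : M) {s t u : k} (hstu : s + t + u = 0) :
    triple (pairAt (prodChar φ₁ x₁) s) (pairAt (prodChar φ₂ x₂) t) (pairAt (prodChar φ₃ x₃) u)
        (yangBaxter ρ.dual.semidirect (symTensor e)) =
      pairAt φ₁ s (ev t (defect ρ (phi k M Q e).atZero x₂ x₃)) +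
        pairAt φ₃ u (ev t (defect ρ (phi k M Q e).atZero x₂ x₁)) -
        pairAt φ₂ t (ev s (defect ρ (phi k M Q e).atZero x₁ x₃)) -
        pairAt φ₂ t (ev u (defect ρ (phi k M Q e).atZero x₃ x₁)) := by
  rw [triple_yangBaxter _ (hasWeight_pairAt _ s) (hasWeight_pairAt _ t), tau_symTensor,
    show -s - t = u by linear_combination -hstu,
    pairAt_prodChar_ev_bracket_contractLeft_symTensor ρ _ _ _ _ _ _ e
      (show t + u + s = 0 by linear_combination hstu),
    pairAt_prodChar_ev_bracket_contractLeft_symTensor ρ _ _ _ _ _ _ e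
      (show t + s + u = 0 by linear_combination hstu),
    pairAt_prodChar_ev_bracket_contractLeft_symTensor ρ _ _ _ _ _ _ e
      (show s + u + t = 0 by linear_combination hstu),
    pairAt_prodChar_ev_bracket_contractLeft_symTensor ρ _ _ _ _ _ _ e
      (show u + s + t = 0 by linear_combination hstu)]
  simp only [pairAt_ev_defect]
  rw [show -t - s = u by linear_combination -hstu, show -t - u = s by linear_combination -hstu,
    show -s - t = u by linear_combination -hstu, show -u - t = s by linear_combination -hstu]
  ring

theorem isCLCYBESolution_symTensor_iff [Module.Free k[X] M] [Module.Free k[X] Q]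
    (ρ : Representation L M) (e : CDual k M ⊗[k] Q) :
    IsCLCYBESolution ρ.dual.semidirect (symTensor e) ↔ IsOOperator ρ (phi k M Q e).atZero := by
  rw [isOOperator_iff_defect_eq_zero, IsCLCYBESolution, mem_range_totalDel_iff]
  constructor
  · intro h x y
    refine eq_zero_of_forall_pairAt_ev_eq_zero (k := k) fun φ u t => ?_
    have hsum : -t - u + t + u = 0 := by ring
    have hvalue := h (prodChar 0 y) (prodChar 0 x) (prodChar φ 0) _ _ _ hsum
    rw [triple_yangBaxter_symTensor ρ e _ _ _ _ _ _ hsum] at hvalue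
    simpa [pairAt_apply] using hvalue
  · intro h f₁ f₂ f₃ s t u hstu
    obtain ⟨φ₁, x₁, rfl⟩ := exists_eq_prodChar f₁
    obtain ⟨φ₂, x₂, rfl⟩ := exists_eq_prodChar f₂
    obtain ⟨φ₃, x₃, rfl⟩ := exists_eq_prodChar f₃
    simp [triple_yangBaxter_symTensor ρ e _ _ _ _ _ _ hstu, h]

end Defect

end

end LeibnizConformal

theorem theorem4p11_general {k : Type*} [Field k] [CharZero k]
    {Q : Type*} [AddCommGroup Q] [Module k Q] [Module k[X] Q] [IsScalarTower k k[X] Q]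
    [Module.Free k[X] Q]
    {M : Type*} [AddCommGroup M] [Module k M] [Module k[X] M] [IsScalarTower k k[X] M]
    [Module.Finite k[X] M] [Module.Free k[X] M]
    (L : LeibnizConformal.LeibnizConformalAlgebra k Q)
    (ρ : LeibnizConformal.Representation L M) (T : LeibnizConformal.Chom k M Q) :
    LeibnizConformal.IsSymmetricSolution ρ.dual.semidirect
        (LeibnizConformal.inclTensor k Q M (LeibnizConformal.eta k M Q T) +
          LeibnizConformal.tau (LeibnizConformal.inclTensor k Q M (LeibnizConformal.eta k M Q T))) ↔
      LeibnizConformal.IsOOperator ρ T.atZero := by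
  have phi_eta : LeibnizConformal.phi k M Q (LeibnizConformal.eta k M Q T) = T :=
    (LinearEquiv.ofBijective _ (LeibnizConformal.phi_bijective k M Q)).apply_symm_apply T
  have solution_iff :=
    LeibnizConformal.isCLCYBESolution_symTensor_iff ρ (LeibnizConformal.eta k M Q T)
  rw [phi_eta] at solution_iff
  exact (and_iff_right (LeibnizConformal.tau_symTensor _)).trans solution_iff

theorem theorem4p11 {k : Type*} [Field k] [CharZero k]
    {Q : Type*} [AddCommGroup Q] [Module k Q] [Module k[X] Q] [IsScalarTower k k[X] Q]
    [Module.Finite k[X] Q] [Module.Free k[X] Q]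
    {M : Type*} [AddCommGroup M] [Module k M] [Module k[X] M] [IsScalarTower k k[X] M]
    [Module.Finite k[X] M] [Module.Free k[X] M]
    (L : LeibnizConformal.LeibnizConformalAlgebra k Q)
    (ρ : LeibnizConformal.Representation L M) (T : LeibnizConformal.Chom k M Q) :
    LeibnizConformal.IsSymmetricSolution ρ.dual.semidirect
        (LeibnizConformal.inclTensor k Q M (LeibnizConformal.eta k M Q T) +
          LeibnizConformal.tau (LeibnizConformal.inclTensor k Q M (LeibnizConformal.eta k M Q T))) ↔
      LeibnizConformal.IsOOperator ρ T.atZero :=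
  theorem4p11_general L ρ T
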